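/- **Setting.** Let $E$ be a locally compact Hausdorff space with a countable base and let $E_\delta=E\cup\{\delta\}$ with $\delta$ an isolated extra point. An *$E$-valued Markov process absorbed at $\delta$*, written $\{Z,P_x\}$, is an $E_\delta$-valued process $(Z_t)_{t\ge 0}$ on a measurable space with a right-continuous, completed filtration $(\mathcal F_t)$ to which it is adapted (completed: $\mathcal F_0$ contains all subsets of the events that are null under every $P_x$) and with probability measures $P_x$, $x\in E_\delta$, such that $P_x(Z_0=x)=1$; $x\mapsto P_x(Z_t\in B)$ is Borel measurable for every $t$ and every Borel set $B$; $Z_t=\delta$ for all $t\ge\zeta(Z):=\inf\{t:Z_t=\delta\}$ (the lifetime); the paths are right-continuous on $[0,\infty)$ and have left limits on $(0,\zeta(Z))$; $Z$ has the strong Markov property for $(\mathcal F_t)$ and is quasi-left-continuous on $[0,\zeta(Z))$; and there is a reference measure, that is, a $\sigma$-finite measure $\mu$ on $E$ such that for every $x\in E$ the potential measure $E_x\big(\int_0^{\zeta(Z)}\mathbf 1_{\{Z_t\in dy\}}\,dt\big)$ is equivalent to $\mu$. Let $d\ge1$, let $S$ be a locally compact subspace of the unit sphere of $\mathbb R^d$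 (Euclidean norm) and let $H=\{ye^z: y\in S,\ z\in\mathbb R\}\subset\mathbb R^d\setminus\{0\}$. Let $\alpha\ge0$. * A *Markov additive process* (MAP) in $S\times\mathbb R$ is an $S\times\mathbb R$-valued Markov process $\{(\theta,\xi),P_{y,z}\}$ absorbed at an extra state $\delta$, with lifetime $\zeta_p$, such that for all $y\in S$, $z\in\mathbb R$, $s,t\ge0$ and all nonnegative measurable $f$ on $S\times\mathbb R$, $$E_{y,z}\big(f(\theta_{t+s},\xi_{t+s}-\xi_t),\,t+s<\zeta_p\,\big|\,\mathcal F_t\big)=E_{\theta_t,0}\big(f(\theta_s,\xi_s),\,s<\zeta_p\big)\mathbf 1_{\{t<\zeta_p\}}.$$ * An *$H$-valued self-similar Markov process* (ssMp) *of index $\alpha$* is an $H$-valued Markov process $\{X,\mathbb P_x\}$ absorbed at $0$ (the point $0$ being regarded as isolated in $H\cup\{0\}$), with lifetime $\zeta_c$, such that for all $a>0$ and $x\in H$ the processes $\{X,\mathbb P_x\}$ and $\{(aX_{a^{-\alpha}t},\,t\ge0),\mathbb P_{a^{-1}x}\}$ have the same law. **Theorem.** (i) Let $\{(\theta,\xi),P_{y,z}\}$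 be a MAP in $S\times\mathbb R$, in a filtration $(\mathcal F_t)$, with lifetime $\zeta_p$ and absorbing state $\delta$. Put $$X_t=\begin{cases}\theta_{\tau_t}e^{\xi_{\tau_t}},& t<\int_0^{\zeta_p}e^{\alpha\xi_s}\,ds,\\ 0,& t\ge\int_0^{\zeta_p}e^{\alpha\xi_s}\,ds,\end{cases}\qquad \tau_t=\inf\Big\{s:\int_0^s e^{\alpha\xi_u}\,du>t\Big\}\ \text{ for } t<\int_0^{\zeta_p}e^{\alpha\xi_s}\,ds,$$ and $\tau_t=\infty$ otherwise, and let $\mathbb P_x=P_{x/\|x\|,\log\|x\|}$ for $x\in H$ and $\mathbb P_0=P_\delta$. Then every $\tau_t$ is a stopping time of $(\mathcal F_t)$ and $\{X,\mathbb P_x\}$ is, in the filtration $(\mathcal F_{\tau_t})$, an $H$-valued ssMp of index $\alpha$, with lifetime $\int_0^{\zeta_p}e^{\alpha\xi_s}\,ds$. (ii) Conversely, let $\{X,\mathbb P_x\}$ be an $H$-valued ssMp of index $\alpha$, in a filtration $(\mathcal F_t)$, with lifetime $\zeta_c$. Put $$(\theta_t,\xi_t)=\begin{cases}\big(X_{A_t}/\|X_{A_t}\|,\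 \log\|X_{A_t}\|\big),& t<\int_0^{\zeta_c}\|X_s\|^{-\alpha}\,ds,\\ \delta,& t\ge\int_0^{\zeta_c}\|X_s\|^{-\alpha}\,ds,\end{cases}\qquad A_t=\inf\Big\{s:\int_0^s\|X_u\|^{-\alpha}\,du>t\Big\}\ \text{ for } t<\int_0^{\zeta_c}\|X_s\|^{-\alpha}\,ds,$$ and $A_t=\infty$ otherwise, and let $P_{y,z}=\mathbb P_{ye^z}$ for $(y,z)\in S\times\mathbb R$ and $P_\delta=\mathbb P_0$. Then every $A_t$ is a stopping time of $(\mathcal F_t)$ and $\{(\theta,\xi),P_{y,z}\}$ is, in the filtration $(\mathcal F_{A_t})$, a MAP in $S\times\mathbb R$, with lifetime $\int_0^{\zeta_c}\|X_s\|^{-\alpha}\,ds$. (iii) For each $\alpha\ge0$ this gives a one-to-one correspondence between MAPs in $S\times\mathbb R$ and $H$-valued ssMps of index $\alpha$: the transformation of (ii) applied to the process and the probability measures obtained in (i) gives back the MAP that one started with, and the transformation of (i) applied to the process and the probability measures obtained in (ii) gives back the ssMp that one started with. -/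

import Mathlib

open MeasureTheory Set Filter Topology
open scoped NNReal ENNReal

namespace LampertiMAP

/-! ### Standard Markov processes with a reference measure -/

/-- The state space `E_δ = E ∪ {δ}`: the topological (and measurable) disjoint union of `E` and one
isolated extra point. -/
abbrev Adj (E : Type*) : Type _ := E ⊕ Unit

/-- The extra absorbing state. -/
abbrev cemetery {E : Type*} : Adj E := Sum.inr ()

/-- A function on `E`, extended by `0` at the extra state. -/
def extendZero {E : Type*} (f : E → ℝ≥0∞) : Adj E → ℝ≥0∞ := Sum.elim f (fun _ => 0)

/-- The lifetime `ζ(Z) = inf {t : Z_t = δ} ∈ [0, ∞]`. -/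
noncomputable def lifetime {Ω E : Type*} (Z : ℝ≥0 → Ω → Adj E) (ω : Ω) : ℝ≥0∞ :=
  sInf {t : ℝ≥0∞ | ∃ s : ℝ≥0, (s : ℝ≥0∞) = t ∧ Z s ω = cemetery}

/-- The integral `∫_0^s f(Z_u) du` over `0 ≤ u < s`, where `s ∈ [0, ∞]`; a function `f` on `E` is
taken to be `0` at the extra state, so that only the times before the lifetime contribute. -/
noncomputable def pathIntegral {Ω E : Type*} (f : E → ℝ≥0∞) (Z : ℝ≥0 → Ω → Adj E) (s : ℝ≥0∞)
    (ω : Ω) : ℝ≥0∞ :=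
  ∫⁻ u in {u : ℝ | 0 ≤ u ∧ ENNReal.ofReal u < s}, extendZero f (Z u.toNNReal ω)

/-- The potential measure `U(x, B) = E_x (∫_0^ζ 1_{Z_t ∈ B} dt)` of a Borel set `B ⊆ E`. -/
noncomputable def potential {Ω E : Type*} [MeasurableSpace Ω] (P : Adj E → Measure Ω)
    (Z : ℝ≥0 → Ω → Adj E) (x : Adj E) (B : Set E) : ℝ≥0∞ :=
  ∫⁻ ω, pathIntegral (B.indicator 1) Z (lifetime Z ω) ω ∂(P x)

/-- `{Z, P_x}` is a standard Markov process in the filtration `𝓕`, with values in `E`, absorbed at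
the isolated extra state, which has a reference measure. -/
structure IsStandardProcess {Ω E : Type*} [m : MeasurableSpace Ω]
    [TopologicalSpace E] [T2Space E] [LocallyCompactSpace E] [SecondCountableTopology E]
    [MeasurableSpace E] [BorelSpace E]
    (𝓕 : Filtration ℝ≥0 m) (P : Adj E → Measure Ω) (Z : ℝ≥0 → Ω → Adj E) : Prop where
  isProbabilityMeasure : ∀ x, IsProbabilityMeasure (P x)
  /-- the filtration is right continuous, -/
  rightContinuous_filtration : 𝓕.IsRightContinuous
  /-- and completed: it contains every subset of an event which is null for all the `P_x`. -/
  complete : ∀ N : Set Ω, MeasurableSet N → (∀ x, P x N = 0) → ∀ A ⊆ N, MeasurableSet[𝓕 0] A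
  adapted : ∀ t, Measurable[𝓕 t] (Z t)
  /-- the transition functions are Borel measurable in the starting point -/
  measurable_transition : ∀ (t : ℝ≥0) (B : Set (Adj E)), MeasurableSet B →
    Measurable (fun x => P x {ω | Z t ω ∈ B})
  start : ∀ x, ∀ᵐ ω ∂(P x), Z 0 ω = x
  absorbed : ∀ (ω : Ω) (t : ℝ≥0), lifetime Z ω ≤ (t : ℝ≥0∞) → Z t ω = cemetery
  rightContinuous : ∀ (ω : Ω) (t : ℝ≥0), ContinuousWithinAt (fun s => Z s ω) (Ici t) t
  leftLimits : ∀ (ω : Ω) (t : ℝ≥0), 0 < t → (t : ℝ≥0∞) < lifetime Z ω →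
    ∃ l : Adj E, Tendsto (fun s => Z s ω) (𝓝[<] t) (𝓝 l)
  /-- the strong Markov property: `P_x (Z_{T+s} ∈ B | 𝓕_T) = P_{Z_T} (Z_s ∈ B)` on `{T < ∞}` -/
  strongMarkov : ∀ (x : Adj E) (T : Ω → WithTop ℝ≥0) (hT : IsStoppingTime 𝓕 T) (s : ℝ≥0)
    (A : Set Ω), MeasurableSet[hT.measurableSpace] A → ∀ B : Set (Adj E), MeasurableSet B →
    P x (A ∩ {ω | T ω ≠ ⊤} ∩ {ω | Z ((T ω).untopD 0 + s) ω ∈ B})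
      = ∫⁻ ω in A ∩ {ω | T ω ≠ ⊤}, P (Z ((T ω).untopD 0) ω) {ω' | Z s ω' ∈ B} ∂(P x)
  /-- quasi-left continuity on `[0, ζ)`: if the stopping times `T n` increase to `T`, then
  `Z_{T n} → Z_T` almost surely on `{T < ζ}` -/
  quasiLeftContinuous : ∀ (x : Adj E) (T : ℕ → Ω → WithTop ℝ≥0),
    (∀ n, IsStoppingTime 𝓕 (T n)) → (∀ n ω, T n ω ≤ T (n + 1) ω) →
    ∀ᵐ ω ∂(P x), ∀ t : ℝ≥0, (⨆ n, T n ω) = (t : WithTop ℝ≥0) → (t : ℝ≥0∞) < lifetime Z ω →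
      Tendsto (fun n => Z ((T n ω).untopD 0) ω) atTop (𝓝 (Z t ω))
  /-- a reference measure: a σ-finite measure to which all potential measures are equivalent -/
  referenceMeasure : ∃ μ : Measure E, SigmaFinite μ ∧
    ∀ (x : E) (B : Set E), MeasurableSet B → (potential P Z (Sum.inl x) B = 0 ↔ μ B = 0)

/-! ### Markov additive processes -/

/-- `f (θ_{t+s}, ξ_{t+s} - ξ_t)` on `{t + s < ζ}`, and `0` elsewhere, as a function of the states at
the times `t` and `t + s`. -/
def onIncrement {S : Type*} (f : S × ℝ → ℝ≥0∞) : Adj (S × ℝ) → Adj (S × ℝ) → ℝ≥0∞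
  | Sum.inl p, Sum.inl q => f (q.1, q.2 - p.2)
  | _, _ => 0

/-- `E_{θ_t, 0} (f (θ_s, ξ_s), s < ζ)` on `{t < ζ}`, and `0` elsewhere, as a function of the state at
the time `t`. -/
noncomputable def restarted {Ω S : Type*} [MeasurableSpace Ω] (P : Adj (S × ℝ) → Measure Ω)
    (Z : ℝ≥0 → Ω → Adj (S × ℝ)) (f : S × ℝ → ℝ≥0∞) (s : ℝ≥0) : Adj (S × ℝ) → ℝ≥0∞
  | Sum.inl p => ∫⁻ ω, extendZero f (Z s ω) ∂(P (Sum.inl (p.1, 0)))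
  | Sum.inr _ => 0

/-- `{Z, P_{y,z}}`, `Z = (θ, ξ)`, is a Markov additive process in `S × ℝ`, in the filtration `𝓕`.
The last field says that
`E_{y,z} (f (θ_{t+s}, ξ_{t+s} - ξ_t), t + s < ζ | 𝓕_t) = E_{θ_t, 0} (f (θ_s, ξ_s), s < ζ) 1_{t < ζ}`,
the conditional expectation being expressed by integrals over the events of `𝓕_t`. -/
structure IsMAP {Ω S : Type*} [m : MeasurableSpace Ω]
    [TopologicalSpace S] [T2Space S] [LocallyCompactSpace S] [SecondCountableTopology S]
    [MeasurableSpace S] [BorelSpace S]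
    (𝓕 : Filtration ℝ≥0 m) (P : Adj (S × ℝ) → Measure Ω) (Z : ℝ≥0 → Ω → Adj (S × ℝ)) :
    Prop where
  standard : IsStandardProcess 𝓕 P Z
  additive : ∀ (x : S × ℝ) (t s : ℝ≥0) (f : S × ℝ → ℝ≥0∞), Measurable f →
    ∀ A : Set Ω, MeasurableSet[𝓕 t] A →
      ∫⁻ ω in A, onIncrement f (Z t ω) (Z (t + s) ω) ∂(P (Sum.inl x))
        = ∫⁻ ω in A, restarted P Z f s (Z t ω) ∂(P (Sum.inl x))

/-! ### Cones of `ℝ^d ∖ {0}` -/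

/-- The unit sphere of `ℝ^d`. -/
abbrev UnitSphere (d : ℕ) : Type := Metric.sphere (0 : EuclideanSpace ℝ (Fin d)) 1

/-- The cone `H = φ(S × ℝ)` of `ℝ^d ∖ {0}`, where `φ(y, z) = y e^z`. -/
def cone {d : ℕ} (S : Set (UnitSphere d)) : Set (EuclideanSpace ℝ (Fin d)) :=
  {x | ∃ y ∈ S, ∃ z : ℝ, x = Real.exp z • (y : EuclideanSpace ℝ (Fin d))}

theorem norm_exp_smul {d : ℕ} (y : UnitSphere d) (z : ℝ) :
    ‖Real.exp z • (y : EuclideanSpace ℝ (Fin d))‖ = Real.exp z := by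
  rw [norm_smul, norm_eq_of_mem_sphere y, Real.norm_eq_abs, abs_of_pos (Real.exp_pos z), mul_one]

theorem cone_norm_pos {d : ℕ} {S : Set (UnitSphere d)} (x : cone S) :
    0 < ‖(x : EuclideanSpace ℝ (Fin d))‖ := by
  obtain ⟨x, y, -, z, rfl⟩ := x
  change 0 < ‖Real.exp z • (y : EuclideanSpace ℝ (Fin d))‖
  rw [norm_exp_smul]
  exact Real.exp_pos z

theorem cone_direction_mem_sphere {d : ℕ} {S : Set (UnitSphere d)} (x : cone S) :
    ‖(x : EuclideanSpace ℝ (Fin d))‖⁻¹ • (x : EuclideanSpace ℝ (Fin d))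
      ∈ Metric.sphere (0 : EuclideanSpace ℝ (Fin d)) 1 := by
  rw [mem_sphere_zero_iff_norm, norm_smul, norm_inv, norm_norm,
    inv_mul_cancel₀ (cone_norm_pos x).ne']

theorem cone_direction_mem {d : ℕ} {S : Set (UnitSphere d)} (x : cone S) :
    (⟨_, cone_direction_mem_sphere x⟩ : UnitSphere d) ∈ S := by
  obtain ⟨x, y, hy, z, rfl⟩ := x
  convert hy using 1
  ext1
  change ‖Real.exp z • (y : EuclideanSpace ℝ (Fin d))‖⁻¹ • Real.exp z •
    (y : EuclideanSpace ℝ (Fin d)) = y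
  rw [norm_exp_smul, smul_smul, inv_mul_cancel₀ (Real.exp_pos z).ne', one_smul]

theorem cone_smul_mem {d : ℕ} {S : Set (UnitSphere d)} {a : ℝ≥0} (ha : 0 < a) (x : cone S) :
    (a : ℝ) • (x : EuclideanSpace ℝ (Fin d)) ∈ cone S := by
  obtain ⟨x, y, hy, z, rfl⟩ := x
  refine ⟨y, hy, Real.log a + z, ?_⟩
  rw [Real.exp_add, Real.exp_log (NNReal.coe_pos.2 ha), smul_smul]

/-- The homeomorphism `φ : S × ℝ → H`, `φ(y, z) = y e^z`, with inverse
`x ↦ (x / ‖x‖, log ‖x‖)`. -/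
noncomputable def polar {d : ℕ} (S : Set (UnitSphere d)) : S × ℝ ≃ₜ cone S where
  toFun p := ⟨Real.exp p.2 • ((p.1 : UnitSphere d) : EuclideanSpace ℝ (Fin d)),
    p.1, p.1.2, p.2, rfl⟩
  invFun x := (⟨⟨‖(x : EuclideanSpace ℝ (Fin d))‖⁻¹ • (x : EuclideanSpace ℝ (Fin d)),
    cone_direction_mem_sphere x⟩, cone_direction_mem x⟩,
    Real.log ‖(x : EuclideanSpace ℝ (Fin d))‖)
  left_inv p := by
    refine Prod.ext (Subtype.ext (Subtype.ext ?_)) ?_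
    · change ‖Real.exp p.2 • ((p.1 : UnitSphere d) : EuclideanSpace ℝ (Fin d))‖⁻¹ •
        Real.exp p.2 • ((p.1 : UnitSphere d) : EuclideanSpace ℝ (Fin d)) = _
      rw [norm_exp_smul, smul_smul, inv_mul_cancel₀ (Real.exp_pos _).ne', one_smul]
    · change Real.log ‖Real.exp p.2 • ((p.1 : UnitSphere d) : EuclideanSpace ℝ (Fin d))‖ = _
      rw [norm_exp_smul, Real.log_exp]
  right_inv x := by
    refine Subtype.ext ?_
    change Real.exp (Real.log ‖(x : EuclideanSpace ℝ (Fin d))‖) •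
      ‖(x : EuclideanSpace ℝ (Fin d))‖⁻¹ • (x : EuclideanSpace ℝ (Fin d)) = _
    rw [Real.exp_log (cone_norm_pos x), smul_smul, mul_inv_cancel₀ (cone_norm_pos x).ne', one_smul]
  continuous_toFun := by
    refine Continuous.subtype_mk ?_ _
    fun_prop
  continuous_invFun := by
    have h : Continuous fun x : cone S => ‖(x : EuclideanSpace ℝ (Fin d))‖ := by fun_prop
    refine Continuous.prodMk (Continuous.subtype_mk (Continuous.subtype_mk ?_ _) _) ?_
    · exact (h.inv₀ fun x => (cone_norm_pos x).ne').smul continuous_subtype_val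
    · exact h.log fun x => (cone_norm_pos x).ne'

instance {d : ℕ} (S : Set (UnitSphere d)) [LocallyCompactSpace S] :
    LocallyCompactSpace (cone S) :=
  (polar S).symm.isClosedEmbedding.locallyCompactSpace

/-! ### Self-similar Markov processes -/

/-- Multiplication by `a > 0` on `H ∪ {0}`. -/
noncomputable def scale {d : ℕ} {S : Set (UnitSphere d)} {a : ℝ≥0} (ha : 0 < a) :
    Adj (cone S) → Adj (cone S) :=
  Sum.map (fun x => ⟨(a : ℝ) • (x : EuclideanSpace ℝ (Fin d)), cone_smul_mem ha x⟩) id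

/-- `{X, ℙ_x}` is an `H`-valued self-similar Markov process of index `α`, in the filtration `𝓕`.
The extra (isolated) state stands for the origin of `ℝ^d`. The last field says that the processes
`{X, ℙ_x}` and `{(a X_{a^{-α} t}, t ≥ 0), ℙ_{a⁻¹ x}}` have the same law. -/
structure IsSsMp {Ω : Type*} [m : MeasurableSpace Ω] {d : ℕ} {S : Set (UnitSphere d)}
    [LocallyCompactSpace S] (α : ℝ) (𝓕 : Filtration ℝ≥0 m) (P : Adj (cone S) → Measure Ω)
    (X : ℝ≥0 → Ω → Adj (cone S)) : Prop where
  standard : IsStandardProcess 𝓕 P X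
  scaling : ∀ (a : ℝ≥0) (ha : 0 < a) (x : cone S),
    (P (Sum.inl x)).map (fun ω (t : ℝ≥0) => X t ω)
      = (P (scale (inv_pos.2 ha) (Sum.inl x))).map
          (fun ω (t : ℝ≥0) => scale ha (X (a ^ (-α) * t) ω))

/-! ### Time changes and the Lamperti transformation -/

/-- The time change `inf {s : ∫_0^s f(Z_u) du > t}` for `t < ∫_0^ζ f(Z_u) du`, and `∞` for the
other values of `t`. -/
noncomputable def inverseClock {Ω E : Type*} (f : E → ℝ≥0∞) (Z : ℝ≥0 → Ω → Adj E) (t : ℝ≥0)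
    (ω : Ω) : WithTop ℝ≥0 :=
  open Classical in
  if (t : ℝ≥0∞) < pathIntegral f Z (lifetime Z ω) ω then
    ((sInf {s : ℝ≥0 | (t : ℝ≥0∞) < pathIntegral f Z s ω} : ℝ≥0) : WithTop ℝ≥0)
  else ⊤

/-- The process `Z` at the time `inf {s : ∫_0^s f(Z_u) du > t}` if `t < ∫_0^ζ f(Z_u) du`, and the
extra state for the other values of `t`. -/
noncomputable def timeChanged {Ω E : Type*} (f : E → ℝ≥0∞) (Z : ℝ≥0 → Ω → Adj E) (t : ℝ≥0)
    (ω : Ω) : Adj E :=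
  open Classical in
  if (t : ℝ≥0∞) < pathIntegral f Z (lifetime Z ω) ω then
    Z (sInf {s : ℝ≥0 | (t : ℝ≥0∞) < pathIntegral f Z s ω}) ω
  else cemetery

/-- The function `(y, z) ↦ e^{α z}` on `S × ℝ`. -/
noncomputable def expWeight {S : Type*} (α : ℝ) (p : S × ℝ) : ℝ≥0∞ :=
  ENNReal.ofReal (Real.exp (α * p.2))

/-- The function `x ↦ ‖x‖^{-α}` on `H`. -/
noncomputable def normWeight {d : ℕ} {S : Set (UnitSphere d)} (α : ℝ) (x : cone S) : ℝ≥0∞ :=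
  ENNReal.ofReal (‖(x : EuclideanSpace ℝ (Fin d))‖ ^ (-α))

/-- The process `X_t = θ_{τ_t} e^{ξ_{τ_t}}` if `t < ∫_0^ζ e^{α ξ_s} ds`, and `X_t = 0` otherwise,
where `τ_t = inf {s : ∫_0^s e^{α ξ_u} du > t}` and `Z = (θ, ξ)`. -/
noncomputable def ssMpOfMAP {Ω : Type*} {d : ℕ} {S : Set (UnitSphere d)} (α : ℝ)
    (Z : ℝ≥0 → Ω → Adj (S × ℝ)) (t : ℝ≥0) (ω : Ω) : Adj (cone S) :=
  Sum.map (polar S) id (timeChanged (expWeight α) Z t ω)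

/-- The measures `ℙ_x = P_{x/‖x‖, log ‖x‖}`, `x ∈ H`, and `ℙ_0 = P_δ`. -/
noncomputable def ssMpLaw {Ω : Type*} [MeasurableSpace Ω] {d : ℕ} {S : Set (UnitSphere d)}
    (P : Adj (S × ℝ) → Measure Ω) (x : Adj (cone S)) : Measure Ω :=
  P (Sum.map (polar S).symm id x)

/-- The process `(θ_t, ξ_t) = (X_{A_t} / ‖X_{A_t}‖, log ‖X_{A_t}‖)` if
`t < ∫_0^ζ ‖X_s‖^{-α} ds`, and `(θ_t, ξ_t) = δ` otherwise, where
`A_t = inf {s : ∫_0^s ‖X_u‖^{-α} du > t}`. -/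
noncomputable def mapOfSsMp {Ω : Type*} {d : ℕ} {S : Set (UnitSphere d)} (α : ℝ)
    (X : ℝ≥0 → Ω → Adj (cone S)) (t : ℝ≥0) (ω : Ω) : Adj (S × ℝ) :=
  Sum.map (polar S).symm id (timeChanged (normWeight α) X t ω)

/-- The measures `P_{y,z} = ℙ_{y e^z}`, `(y, z) ∈ S × ℝ`, and `P_δ = ℙ_0`. -/
noncomputable def mapLaw {Ω : Type*} [MeasurableSpace Ω] {d : ℕ} {S : Set (UnitSphere d)}
    (P : Adj (cone S) → Measure Ω) (p : Adj (S × ℝ)) : Measure Ω :=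
  P (Sum.map (polar S) id p)

end LampertiMAP

namespace LampertiMAP

/-! ### Topology and measurability of the enlarged state space -/

/-! Both transformations are instances of one operation: a time change by the clock `C_s = ∫_0^s
f(Z_u) du`, where `f` is continuous, strictly positive and finite, followed by the homeomorphism
`polar` or its inverse.

Pathwise, right continuity and left limits make `f(Z)` bounded on compact intervals of times before
the lifetime. There the clock is therefore finite, continuous and strictly increasing, so its right
inverse `τ` is a true inverse and the time change merely reparametrises the path. The substitution
formula `IsRegularPath.pathIntegral_timeChanged` shows that the clock of the new path with weight
`1/f` is `τ`; hence a second time change with weight `1/f` restores the original path. In polar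
coordinates `e^{αz}` and `‖x‖^{-α}` are reciprocal, which makes the two transformations inverse to
each other.

Probabilistically, the time change of a standard process is standard
(`IsStandardProcess.timeChange`). The equivalence `τ_t < u ↔ t < C_u` and right continuity of the
filtration give that `τ_t`, and more generally `τ_T` for a stopping time `T` of the new filtration,
is a stopping time of the old one, with a larger past. The new path after `T` is the time change of
the old path after `τ_T`, so the strong Markov property at `T` follows from the one at `τ_T`, once
the latter is known for events of the whole path (`IsStandardProcess.strongMarkov_path`). Quasi-left
continuity follows because `τ` carries suprema to suprema, and the reference measure persists
because a positive finite weight does not change which sets are visited for a null time.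

The additive and scaling properties correspond through `polar`, which turns translation of `ξ` by
`log a` into multiplication by `a`. For a standard process, the additive property amounts to
invariance in law under translations of `ξ` (`IsMAP.law_eq_translate`, `IsStandardProcess.isMAP`).
Translation by `log a` multiplies the weight `e^{αξ}` by `a^α`, which slows the new process by the
factor `a^{-α}` of self-similarity. Conversely, scaling by `a` multiplies `‖x‖^{-α}` by `a^{-α}`,
which exactly cancels the change of time in the scaling relation and leaves a translation. Both
computations are cases of `IsRegularPath.timeChanged_map`. -/

instance {E : Type*} [TopologicalSpace E] [TopologicalSpace.PseudoMetrizableSpace E] :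
    TopologicalSpace.PseudoMetrizableSpace (Adj E) := by
  let _ := TopologicalSpace.pseudoMetrizableSpacePseudoMetric E
  have : (uniformity (E ⊕ Unit)).IsCountablyGenerated := by
    rw [Sum.uniformity]
    infer_instance
  exact UniformSpace.pseudoMetrizableSpace

instance {E : Type*} [TopologicalSpace E] [MeasurableSpace E] [BorelSpace E] :
    BorelSpace (Adj E) := by
  refine ⟨le_antisymm ?_ ?_⟩
  · intro s hs
    -- The statement is made for an abstract `γ` so that it can be applied to `E ⊕ Unit` with the
    -- Borel σ-algebra instead of the sum instance.
    have h1 : ∀ (γ : Type _) [TopologicalSpace γ] [MeasurableSpace γ] [BorelSpace γ]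
        (i : E → γ) (j : Unit → γ), IsOpenEmbedding i → IsOpenEmbedding j →
        MeasurableSet (i '' (Sum.inl ⁻¹' s) ∪ j '' (Sum.inr ⁻¹' s)) := fun γ _ _ _ i j hi hj =>
      (hi.measurableEmbedding.measurableSet_image.2 hs.1).union
        (hj.measurableEmbedding.measurableSet_image.2 hs.2)
    rw [← image_preimage_inl_union_image_preimage_inr s]
    exact @h1 (E ⊕ Unit) _ (borel _) (@BorelSpace.mk _ _ (borel _) rfl) _ _ .inl .inr
  · refine MeasurableSpace.generateFrom_le fun u hu => ?_
    exact measurableSet_sum_iff.2 ⟨(hu.preimage continuous_inl).measurableSet, trivial⟩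

/-- The process is the pointwise limit of processes that are piecewise constant in time, sampled at
grid points to the right of the current time. -/
theorem measurable_uncurry_of_rightContinuous {Ω β : Type*} {mΩ : MeasurableSpace Ω}
    [TopologicalSpace β] [TopologicalSpace.PseudoMetrizableSpace β] [MeasurableSpace β]
    [BorelSpace β] {Z : ℝ≥0 → Ω → β} (hZ : ∀ t, Measurable (Z t))
    (hr : ∀ ω t, ContinuousWithinAt (fun s => Z s ω) (Ici t) t) :
    Measurable (fun p : ℝ≥0 × Ω => Z p.1 p.2) := by
  -- The first point of the grid of mesh `1 / (n + 1)` strictly after `t`. Approaching from the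
  -- right is what right continuity requires.
  let d : ℕ → ℝ≥0 → ℝ≥0 := fun n t => ((⌊t * (n + 1)⌋₊ : ℝ≥0) + 1) / (n + 1)
  have hd1 : ∀ n t, t ≤ d n t := fun n t => by
    rw [le_div_iff₀ (by positivity)]
    exact (Nat.lt_floor_add_one _).le
  have hd2 : ∀ n t, d n t ≤ t + 1 / (n + 1) := fun n t => by
    rw [div_le_iff₀ (by positivity), add_mul, div_mul_cancel₀ _ (by positivity)]
    gcongr
    exact Nat.floor_le (by positivity)
  refine measurable_of_tendsto_metrizable (f := fun n (p : ℝ≥0 × Ω) => Z (d n p.1) p.2)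
    (fun n => ?_) (tendsto_pi_nhds.2 fun p => ?_)
  · let g : ℕ × Ω → β := fun q => Z (((q.1 : ℝ≥0) + 1) / (n + 1)) q.2
    let k : ℝ≥0 × Ω → ℕ × Ω := fun p => (⌊p.1 * (n + 1)⌋₊, p.2)
    have h1 : Measurable g :=
      measurable_from_prod_countable_right fun k => hZ (((k : ℝ≥0) + 1) / (n + 1))
    have h2 : Measurable k :=
      (Nat.measurable_floor.comp (measurable_fst.mul_const _)).prodMk measurable_snd
    change Measurable (g ∘ k)
    exact h1.comp h2
  · have h1 : Tendsto (fun n => d n p.1) atTop (𝓝[≥] p.1) := by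
      refine tendsto_nhdsWithin_iff.2 ⟨?_, Eventually.of_forall fun n => hd1 n p.1⟩
      refine tendsto_of_tendsto_of_tendsto_of_le_of_le tendsto_const_nhds ?_
        (fun n => hd1 n p.1) (fun n => hd2 n p.1)
      have := tendsto_one_div_add_atTop_nhds_zero_nat (𝕜 := ℝ≥0)
      simpa using tendsto_const_nhds.add this
    exact (hr p.2 p.1).tendsto.comp h1

theorem lifetime_le {Ω E : Type*} {Z : ℝ≥0 → Ω → Adj E} {ω : Ω} {t : ℝ≥0}
    (h : Z t ω = cemetery) : lifetime Z ω ≤ t :=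
  sInf_le ⟨t, rfl, h⟩

/-! ### Regular paths and clock weights -/

section Path

variable {Ω E : Type*} [TopologicalSpace E]

/-- The path regularity of a standard process: absorption, right continuity and left limits. -/
structure IsRegularPath (w : ℝ≥0 → Adj E) : Prop where
  absorbed : ∀ s t, s ≤ t → w s = cemetery → w t = cemetery
  rightContinuous : ∀ t, ContinuousWithinAt w (Ici t) t
  leftLimits : ∀ t, 0 < t → w t ≠ cemetery → ∃ l, Tendsto w (𝓝[<] t) (𝓝 l)

/-- A weight which defines a time change: continuous, positive and finite. -/
structure IsClockWeight (f : E → ℝ≥0∞) : Prop where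
  continuous : Continuous f
  ne_zero : ∀ x, f x ≠ 0
  ne_top : ∀ x, f x ≠ ⊤

variable {Z : ℝ≥0 → Ω → Adj E} {ω : Ω} {f : E → ℝ≥0∞}

theorem IsClockWeight.inv (hf : IsClockWeight f) : IsClockWeight fun x => (f x)⁻¹ where
  continuous := continuous_inv.comp hf.continuous
  ne_zero x := ENNReal.inv_ne_zero.2 (hf.ne_top x)
  ne_top x := ENNReal.inv_ne_top.2 (hf.ne_zero x)

theorem IsClockWeight.continuous_extendZero (hf : IsClockWeight f) :
    Continuous (extendZero f) := continuous_sum_dom.2 ⟨hf.continuous, continuous_const⟩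

theorem IsClockWeight.extendZero_ne_top (hf : IsClockWeight f) (x : Adj E) :
    extendZero f x ≠ ⊤ := by
  rcases x with x | x
  · exact hf.ne_top x
  · exact ENNReal.zero_ne_top

theorem IsClockWeight.extendZero_pos (hf : IsClockWeight f) {x : Adj E} (hx : x ≠ cemetery) :
    0 < extendZero f x := by
  rcases x with x | x
  · exact pos_iff_ne_zero.2 (hf.ne_zero x)
  · exact absurd rfl hx

theorem IsRegularPath.shift (h : IsRegularPath fun t => Z t ω) (r : ℝ≥0) :
    IsRegularPath fun t => Z (r + t) ω where
  absorbed s t hst := h.absorbed _ _ (by gcongr)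
  rightContinuous t := by
    have h1 := h.rightContinuous (r + t)
    exact h1.comp (f := fun s => r + s) (by fun_prop) fun s hs => add_le_add_right hs r
  leftLimits t ht hz := by
    obtain ⟨l, hl⟩ := h.leftLimits (r + t) (by positivity) hz
    refine ⟨l, hl.comp (tendsto_nhdsWithin_iff.2 ⟨?_, ?_⟩)⟩
    · exact (Continuous.tendsto (by fun_prop : Continuous fun s : ℝ≥0 => r + s) t).mono_left
        nhdsWithin_le_nhds
    · filter_upwards [self_mem_nhdsWithin] with s hs
      exact add_lt_add_right hs r

/-- The extra state is isolated, so `E` is a neighbourhood of `Z t ω` and right continuity keeps the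
path in it for a while. Consequently being alive at `t` means that `t` is strictly below the
lifetime. -/
theorem IsRegularPath.exists_alive (h : IsRegularPath fun t => Z t ω) {t : ℝ≥0}
    (ht : Z t ω ≠ cemetery) : ∃ r, t < r ∧ Z r ω ≠ cemetery := by
  have h1 : range (Sum.inl : E → Adj E) ∈ 𝓝 (Z t ω) := by
    refine isOpen_range_inl.mem_nhds ?_
    rcases hz : Z t ω with x | x
    · exact ⟨x, rfl⟩
    · exact absurd hz ht
  obtain ⟨u, hu, hs⟩ := mem_nhdsGE_iff_exists_Ico_subset.1 ((h.rightContinuous t) h1)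
  obtain ⟨r, hr1, hr2⟩ := exists_between (show t < u from hu)
  refine ⟨r, hr1, fun h2 => ?_⟩
  obtain ⟨x, hx⟩ := hs ⟨hr1.le, hr2⟩
  have hx' : Sum.inl x = Z r ω := hx
  rw [h2] at hx'
  cases hx'

theorem IsRegularPath.lt_lifetime_iff (h : IsRegularPath fun t => Z t ω) {t : ℝ≥0} :
    (t : ℝ≥0∞) < lifetime Z ω ↔ Z t ω ≠ cemetery := by
  refine ⟨fun h1 h2 => absurd (lifetime_le h2) (not_le.2 h1), fun h1 => ?_⟩
  obtain ⟨r, hr, h2⟩ := h.exists_alive h1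
  refine (ENNReal.coe_lt_coe.2 hr).trans_le (le_sInf ?_)
  rintro _ ⟨s, rfl, hs⟩
  refine ENNReal.coe_le_coe.2 (le_of_not_gt fun h3 => h2 (h.absorbed _ _ h3.le hs))

theorem IsRegularPath.alive_mono (h : IsRegularPath fun t => Z t ω) {s t : ℝ≥0} (hst : s ≤ t)
    (ht : Z t ω ≠ cemetery) : Z s ω ≠ cemetery := fun hs => ht (h.absorbed s t hst hs)

/-- Near each time the weight is bounded on the right by right continuity and on the left by the
existence of a left limit; compactness of `[0, s]` makes the bound uniform. The left limits are
available because the path is alive up to `s`. -/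
theorem IsRegularPath.exists_bound (h : IsRegularPath fun t => Z t ω) (hf : IsClockWeight f)
    {s : ℝ≥0} (hs : Z s ω ≠ cemetery) :
    ∃ M : ℝ≥0, ∀ u ≤ s, extendZero f (Z u ω) ≤ M := by
  have key : ∃ M : ℝ≥0, ∀ u ∈ Icc 0 s, extendZero f (Z u ω) ≤ M := by
    refine isCompact_Icc.induction_on (p := fun K => ∃ M : ℝ≥0, ∀ u ∈ K, extendZero f (Z u ω) ≤ M)
      ⟨0, by simp⟩ (fun K L hKL ⟨M, hM⟩ => ⟨M, fun u hu => hM u (hKL hu)⟩) ?_ ?_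
    · rintro K L ⟨M, hM⟩ ⟨N, hN⟩
      refine ⟨max M N, fun u hu => ?_⟩
      rw [ENNReal.coe_max]
      rcases hu with hu | hu
      · exact le_max_of_le_left (hM u hu)
      · exact le_max_of_le_right (hN u hu)
    · intro t ht
      have bd : ∀ x : Adj E, ∃ M : ℝ≥0, {y | extendZero f y ≤ M} ∈ 𝓝 x := fun x => by
        obtain ⟨M, hM⟩ := ENNReal.lt_iff_exists_nnreal_btwn.1 (hf.extendZero_ne_top x).lt_top
        refine ⟨M, ?_⟩
        filter_upwards [(hf.continuous_extendZero.tendsto x).eventually (gt_mem_nhds hM.1)]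
          with y hy using hy.le
      obtain ⟨M, hM⟩ := bd (Z t ω)
      have h1 : ∀ᶠ u in 𝓝[≥] t, extendZero f (Z u ω) ≤ M := h.rightContinuous t hM
      have h2 : ∃ N : ℝ≥0, ∀ᶠ u in 𝓝[<] t, extendZero f (Z u ω) ≤ N := by
        rcases eq_or_lt_of_le (zero_le : 0 ≤ t) with rfl | h0
        · exact ⟨0, by simp⟩
        · obtain ⟨l, hl⟩ := h.leftLimits t h0 (h.alive_mono ht.2 hs)
          obtain ⟨N, hN⟩ := bd l
          exact ⟨N, hl hN⟩
      obtain ⟨N, hN⟩ := h2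
      refine ⟨{u | extendZero f (Z u ω) ≤ (max M N : ℝ≥0)}, mem_nhdsWithin_of_mem_nhds ?_,
        max M N, fun u hu => hu⟩
      rw [← nhdsLT_sup_nhdsGE, mem_sup]
      constructor
      · filter_upwards [hN] with u hu
        exact hu.trans (ENNReal.coe_le_coe.2 (le_max_right _ _))
      · filter_upwards [h1] with u hu
        exact hu.trans (ENNReal.coe_le_coe.2 (le_max_left _ _))
  obtain ⟨M, hM⟩ := key
  exact ⟨M, fun u hu => hM u ⟨zero_le, hu⟩⟩

end Path

/-! ### The clock of a regular path -/

theorem measurable_extendZero {E : Type*} [MeasurableSpace E] {f : E → ℝ≥0∞} (hf : Measurable f) :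
    Measurable (extendZero f) :=
  measurable_fun_sum hf measurable_const

section Clock

variable {Ω E : Type*} {Z : ℝ≥0 → Ω → Adj E} {ω : Ω} {f : E → ℝ≥0∞}

theorem measurableSet_timeSet (s : ℝ≥0∞) :
    MeasurableSet {u : ℝ | 0 ≤ u ∧ ENNReal.ofReal u < s} :=
  measurableSet_Ici.inter (measurableSet_lt ENNReal.measurable_ofReal measurable_const)

theorem timeSet_coe (s : ℝ≥0) : {u : ℝ | 0 ≤ u ∧ ENNReal.ofReal u < s} = Ico 0 (s : ℝ) := by
  ext u
  refine and_congr_right fun hu => ?_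
  rw [← ENNReal.ofReal_coe_nnreal, ENNReal.ofReal_lt_ofReal_iff_of_nonneg hu]

theorem pathIntegral_coe (s : ℝ≥0) :
    pathIntegral f Z s ω = ∫⁻ u in Ico (0 : ℝ) s, extendZero f (Z u.toNNReal ω) := by
  rw [pathIntegral, timeSet_coe]

theorem pathIntegral_mono {s t : ℝ≥0∞} (h : s ≤ t) :
    pathIntegral f Z s ω ≤ pathIntegral f Z t ω :=
  lintegral_mono_set fun _ hu => ⟨hu.1, hu.2.trans_le h⟩

theorem pathIntegral_zero : pathIntegral f Z 0 ω = 0 := by simp [pathIntegral]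

/-- Additivity of the clock along the shift of the path; everything about restarting the time change
rests on it. -/
theorem pathIntegral_add (r : ℝ≥0) (s : ℝ≥0∞) :
    pathIntegral f Z (r + s) ω
      = pathIntegral f Z r ω + pathIntegral f (fun t => Z (r + t)) s ω := by
  have h1 : {u : ℝ | 0 ≤ u ∧ ENNReal.ofReal u < r + s}
      = {u : ℝ | 0 ≤ u ∧ ENNReal.ofReal u < r}
        ∪ {u : ℝ | (r : ℝ) ≤ u ∧ ENNReal.ofReal u < r + s} := by
    ext u
    simp only [mem_ofPred_eq, mem_union]
    constructor
    · rintro ⟨hu, hs⟩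
      rcases lt_or_ge u r with h | h
      · refine Or.inl ⟨hu, ?_⟩
        rwa [← ENNReal.ofReal_coe_nnreal, ENNReal.ofReal_lt_ofReal_iff_of_nonneg hu]
      · exact Or.inr ⟨h, hs⟩
    · rintro (⟨hu, hs⟩ | ⟨hu, hs⟩)
      · exact ⟨hu, hs.trans_le le_self_add⟩
      · exact ⟨r.2.trans hu, hs⟩
  have h2 : MeasurableSet {u : ℝ | (r : ℝ) ≤ u ∧ ENNReal.ofReal u < r + s} :=
    measurableSet_Ici.inter (measurableSet_lt ENNReal.measurable_ofReal measurable_const)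
  rw [pathIntegral, h1, lintegral_union h2]
  · congr 1
    rw [pathIntegral]
    have h3 := (measurePreserving_add_left (volume : Measure ℝ) (r : ℝ))
      |>.setLIntegral_comp_preimage_emb
      (measurableEmbedding_addLeft (r : ℝ)) (fun u => extendZero f (Z u.toNNReal ω))
      {u : ℝ | (r : ℝ) ≤ u ∧ ENNReal.ofReal u < r + s}
    rw [← h3]
    have h4 : (fun u => (r : ℝ) + u) ⁻¹' {u : ℝ | (r : ℝ) ≤ u ∧ ENNReal.ofReal u < r + s}
        = {u : ℝ | 0 ≤ u ∧ ENNReal.ofReal u < s} := by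
      ext u
      simp only [mem_preimage, mem_ofPred_eq, le_add_iff_nonneg_right]
      refine and_congr_right fun hu => ?_
      rw [ENNReal.ofReal_add r.coe_nonneg hu, ENNReal.ofReal_coe_nnreal,
        ENNReal.add_lt_add_iff_left ENNReal.coe_ne_top]
    rw [h4]
    refine setLIntegral_congr_fun (measurableSet_timeSet s) fun u hu => ?_
    simp only [Real.toNNReal_add r.coe_nonneg hu.1, Real.toNNReal_coe]
  · rw [Set.disjoint_left]
    rintro u ⟨hu, hs⟩ ⟨hu', -⟩
    rw [← ENNReal.ofReal_coe_nnreal, ENNReal.ofReal_lt_ofReal_iff_of_nonneg hu] at hs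
    exact absurd hu' (not_le.2 hs)

theorem lt_pathIntegral_iff {t s : ℝ≥0∞} :
    t < pathIntegral f Z s ω ↔ ∃ r : ℝ≥0, (r : ℝ≥0∞) < s ∧ t < pathIntegral f Z r ω := by
  refine ⟨fun h => ?_, fun ⟨r, hr, h⟩ => h.trans_le (pathIntegral_mono hr.le)⟩
  have hs : 0 < s := pos_iff_ne_zero.2 fun hs => by simp [hs, pathIntegral_zero] at h
  obtain ⟨u, hu, hus, hlim⟩ := exists_seq_strictMono_tendsto' hs
  have h1 : {v : ℝ | 0 ≤ v ∧ ENNReal.ofReal v < s}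
      = ⋃ n, {v : ℝ | 0 ≤ v ∧ ENNReal.ofReal v < u n} := by
    ext v
    simp only [mem_ofPred_eq, mem_iUnion, exists_and_left]
    exact and_congr_right fun _ => ⟨fun hv => (hlim.eventually (lt_mem_nhds hv)).exists,
      fun ⟨n, hn⟩ => hn.trans (hus n).2⟩
  have h2 : Monotone fun n => {v : ℝ | 0 ≤ v ∧ ENNReal.ofReal v < u n} :=
    fun m n hmn v hv => ⟨hv.1, hv.2.trans_le (hu.monotone hmn)⟩
  -- Read as a measure of an increasing union of time intervals, the integral is continuous from
  -- below, with no measurability needed of the integrand.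
  rw [pathIntegral, ← withDensity_apply _ (measurableSet_timeSet s), h1, h2.measure_iUnion] at h
  obtain ⟨n, hn⟩ := lt_iSup_iff.1 h
  rw [withDensity_apply _ (measurableSet_timeSet _)] at hn
  have h3 := ((hus n).2.trans_le le_top).ne
  lift u n to ℝ≥0 using h3 with r hr
  exact ⟨r, hr ▸ (hus n).2, hn⟩

theorem pathIntegral_le_mul {M s : ℝ≥0} (hM : ∀ u ≤ s, extendZero f (Z u ω) ≤ M) :
    pathIntegral f Z s ω ≤ M * s := by
  rw [pathIntegral_coe]
  refine (setLIntegral_mono' (g := fun _ => (M : ℝ≥0∞)) measurableSet_Ico fun u hu =>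
    hM _ ?_).trans ?_
  · rw [Real.toNNReal_le_iff_le_coe]
    exact hu.2.le
  · simp

variable [TopologicalSpace E]

theorem IsRegularPath.pathIntegral_eq_zero (h : IsRegularPath fun t => Z t ω)
    (h0 : Z 0 ω = cemetery) (s : ℝ≥0∞) : pathIntegral f Z s ω = 0 := by
  rw [pathIntegral, lintegral_congr (g := fun _ => 0), lintegral_zero]
  intro u
  rw [h.absorbed 0 _ zero_le h0]
  rfl

theorem IsRegularPath.pathIntegral_eq_of_dead (h : IsRegularPath fun t => Z t ω) {r : ℝ≥0}
    (hr : Z r ω = cemetery) {s : ℝ≥0∞} (hs : r ≤ s) :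
    pathIntegral f Z s ω = pathIntegral f Z r ω := by
  rw [← add_tsub_cancel_of_le hs, pathIntegral_add,
    (h.shift r).pathIntegral_eq_zero (by simpa using hr), add_zero]

theorem IsRegularPath.pathIntegral_lifetime (h : IsRegularPath fun t => Z t ω) :
    pathIntegral f Z (lifetime Z ω) ω = pathIntegral f Z ⊤ ω := by
  rcases eq_or_ne (lifetime Z ω) ⊤ with h1 | h1
  · rw [h1]
  · lift lifetime Z ω to ℝ≥0 using h1 with r hr
    refine (h.pathIntegral_eq_of_dead ?_ le_top).symm
    by_contra h2
    exact absurd (h.lt_lifetime_iff.2 h2) (by rw [← hr]; exact lt_irrefl _)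

theorem IsClockWeight.measurable [MeasurableSpace E] [BorelSpace E] (hf : IsClockWeight f) :
    Measurable f :=
  hf.continuous.measurable

theorem IsRegularPath.pathIntegral_ne_top (h : IsRegularPath fun t => Z t ω)
    (hf : IsClockWeight f) {s : ℝ≥0} (hs : Z s ω ≠ cemetery) :
    pathIntegral f Z s ω ≠ ⊤ := by
  obtain ⟨M, hM⟩ := h.exists_bound hf hs
  exact ((pathIntegral_le_mul hM).trans_lt (ENNReal.mul_lt_top ENNReal.coe_lt_top
    ENNReal.coe_lt_top)).ne

theorem IsRegularPath.exists_pathIntegral_eq (h : IsRegularPath fun t => Z t ω)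
    (hf : IsClockWeight f) {t : ℝ≥0∞} (ht : t < pathIntegral f Z (lifetime Z ω) ω) :
    ∃ r : ℝ≥0, Z r ω ≠ cemetery ∧ pathIntegral f Z r ω = t := by
  obtain ⟨b, hb, h1⟩ := lt_pathIntegral_iff.1 ht
  rw [h.lt_lifetime_iff] at hb
  obtain ⟨M, hM⟩ := h.exists_bound hf hb
  -- Stopped at `b`, the clock is Lipschitz with constant the bound `M` of the weight on `[0, b]`.
  -- The intermediate value theorem then applies, since the clock exceeds `t` at `b`.
  have hc : Continuous fun r : ℝ≥0 => pathIntegral f Z (min r b : ℝ≥0) ω := by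
    refine continuous_of_le_add_edist M ENNReal.coe_ne_top fun x y => ?_
    rcases le_total x y with h2 | h2
    · exact (pathIntegral_mono (by gcongr)).trans le_self_add
    · have h3 : (min x b : ℝ≥0) = min y b + (min x b - min y b) :=
        (add_tsub_cancel_of_le (by gcongr)).symm
      rw [h3, ENNReal.coe_add, pathIntegral_add]
      gcongr
      have h4 : pathIntegral f (fun t => Z (min y b + t)) (min x b - min y b : ℝ≥0) ω
          ≤ M * (min x b - min y b : ℝ≥0) := by
        refine pathIntegral_le_mul fun u hu => hM _ ?_
        calc min y b + u ≤ min y b + (min x b - min y b) := by gcongr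
          _ = min x b := h3.symm
          _ ≤ b := min_le_right _ _
      refine h4.trans ?_
      gcongr
      rw [edist_nndist, NNReal.nndist_eq, ENNReal.coe_le_coe]
      refine le_max_of_le_left (tsub_le_iff_right.2 ?_)
      rcases le_total y b with h5 | h5
      · rw [min_eq_left h5, tsub_add_cancel_of_le h2]
        exact min_le_left _ _
      · rw [min_eq_right h5]
        exact (min_le_right _ _).trans le_add_self
  obtain ⟨r, hr, h2⟩ := intermediate_value_Icc (zero_le : 0 ≤ b) hc.continuousOn
    (show t ∈ Icc _ _ from ⟨by simp [pathIntegral_zero], by simpa using h1.le⟩)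
  exact ⟨r, h.alive_mono hr.2 hb, by simpa [min_eq_left hr.2] using h2⟩

variable [TopologicalSpace.PseudoMetrizableSpace E] [MeasurableSpace E] [BorelSpace E]

theorem IsRegularPath.measurable (h : IsRegularPath fun t => Z t ω) :
    Measurable fun t => Z t ω :=
  -- A single path is a process on a one-point probability space.
  (measurable_uncurry_of_rightContinuous (Ω := Unit) (mΩ := ⊤) (Z := fun t _ => Z t ω)
    (fun _ => measurable_const) fun _ => h.rightContinuous).comp
    (measurable_id.prodMk (measurable_const (a := ())))

theorem IsRegularPath.measurable_rate (h : IsRegularPath fun t => Z t ω) (hf : Measurable f) :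
    Measurable fun u : ℝ => extendZero f (Z u.toNNReal ω) :=
  (measurable_extendZero hf).comp (h.measurable.comp measurable_real_toNNReal)

theorem IsRegularPath.pathIntegral_pos (h : IsRegularPath fun t => Z t ω) (hf : IsClockWeight f)
    (h0 : Z 0 ω ≠ cemetery) {s : ℝ≥0∞} (hs : 0 < s) : 0 < pathIntegral f Z s ω := by
  obtain ⟨r, hr, h1⟩ := h.exists_alive h0
  obtain ⟨q, hq0, hq⟩ := ENNReal.lt_iff_exists_nnreal_btwn.1
    (lt_min hs (ENNReal.coe_pos.2 hr))
  rw [lt_min_iff] at hq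
  refine lt_of_lt_of_le ?_ (pathIntegral_mono hq.1.le)
  rw [pathIntegral_coe, setLIntegral_pos_iff (h.measurable_rate hf.measurable)]
  refine lt_of_lt_of_le ?_ (measure_mono (s := Ico (0 : ℝ) q) fun u hu => ⟨?_, hu⟩)
  · simpa using hq0
  · refine (hf.extendZero_pos (h.alive_mono ?_ h1)).ne'
    rw [Real.toNNReal_le_iff_le_coe]
    exact hu.2.le.trans (by exact_mod_cast hq.2.le)

theorem IsRegularPath.pathIntegral_lt (h : IsRegularPath fun t => Z t ω)
    (hf : IsClockWeight f) {r : ℝ≥0} (hr : Z r ω ≠ cemetery) {s : ℝ≥0∞} (hs : r < s) :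
    pathIntegral f Z r ω < pathIntegral f Z s ω := by
  rw [← add_tsub_cancel_of_le hs.le, pathIntegral_add]
  refine ENNReal.lt_add_right (h.pathIntegral_ne_top hf hr)
    ((h.shift r).pathIntegral_pos hf (by simpa using hr) (tsub_pos_of_lt hs)).ne'

theorem IsRegularPath.pathIntegral_lt_iff (h : IsRegularPath fun t => Z t ω)
    (hf : IsClockWeight f) {r : ℝ≥0} (hr : Z r ω ≠ cemetery) {s : ℝ≥0∞} :
    pathIntegral f Z r ω < pathIntegral f Z s ω ↔ r < s :=
  ⟨fun h1 => lt_of_not_ge fun h2 => absurd h1 (not_lt.2 (pathIntegral_mono h2)),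
    h.pathIntegral_lt hf hr⟩

theorem IsRegularPath.pathIntegral_lt_lifetime (h : IsRegularPath fun t => Z t ω)
    (hf : IsClockWeight f) {r : ℝ≥0} (hr : Z r ω ≠ cemetery) :
    pathIntegral f Z r ω < pathIntegral f Z (lifetime Z ω) ω :=
  h.pathIntegral_lt hf hr (h.lt_lifetime_iff.2 hr)

/-- Strict monotonicity while alive makes the set exactly `(r, ∞)`. Together with
`IsRegularPath.exists_pathIntegral_eq` this replaces the infimum by the unique time `r` at which the
clock shows `t`. -/
theorem IsRegularPath.sInf_clock (h : IsRegularPath fun t => Z t ω)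
    (hf : IsClockWeight f) {r t : ℝ≥0} (hr : Z r ω ≠ cemetery) (ht : pathIntegral f Z r ω = t) :
    sInf {s : ℝ≥0 | (t : ℝ≥0∞) < pathIntegral f Z s ω} = r := by
  have : {s : ℝ≥0 | (t : ℝ≥0∞) < pathIntegral f Z s ω} = Ioi r := by
    ext s
    rw [mem_ofPred_eq, ← ht, h.pathIntegral_lt_iff hf hr, ENNReal.coe_lt_coe, mem_Ioi]
  rw [this, csInf_Ioi]

theorem IsRegularPath.inverseClock_eq (h : IsRegularPath fun t => Z t ω)
    (hf : IsClockWeight f) {r t : ℝ≥0} (hr : Z r ω ≠ cemetery) (ht : pathIntegral f Z r ω = t) :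
    inverseClock f Z t ω = r := by
  rw [inverseClock, if_pos (ht ▸ h.pathIntegral_lt_lifetime hf hr), h.sInf_clock hf hr ht]

theorem IsRegularPath.timeChanged_eq (h : IsRegularPath fun t => Z t ω)
    (hf : IsClockWeight f) {r t : ℝ≥0} (hr : Z r ω ≠ cemetery) (ht : pathIntegral f Z r ω = t) :
    timeChanged f Z t ω = Z r ω := by
  rw [timeChanged, if_pos (ht ▸ h.pathIntegral_lt_lifetime hf hr), h.sInf_clock hf hr ht]

end Clock

theorem inverseClock_eq_top {Ω E : Type*} {Z : ℝ≥0 → Ω → Adj E} {ω : Ω} {f : E → ℝ≥0∞} {t : ℝ≥0}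
    (ht : pathIntegral f Z (lifetime Z ω) ω ≤ t) : inverseClock f Z t ω = ⊤ :=
  if_neg (not_lt.2 ht)

theorem timeChanged_eq_cemetery {Ω E : Type*} {Z : ℝ≥0 → Ω → Adj E} {ω : Ω} {f : E → ℝ≥0∞}
    {t : ℝ≥0} (ht : pathIntegral f Z (lifetime Z ω) ω ≤ t) : timeChanged f Z t ω = cemetery :=
  if_neg (not_lt.2 ht)

/-! ### The time-changed path -/

theorem IsRegularPath.exists_or_dead {Ω E : Type*} [TopologicalSpace E]
    {Z : ℝ≥0 → Ω → Adj E} {ω : Ω} {f : E → ℝ≥0∞} (h : IsRegularPath fun t => Z t ω)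
    (hf : IsClockWeight f)
    (t : ℝ≥0) : (∃ r : ℝ≥0, Z r ω ≠ cemetery ∧ pathIntegral f Z r ω = t)
      ∨ pathIntegral f Z (lifetime Z ω) ω ≤ t := by
  rcases lt_or_ge (t : ℝ≥0∞) (pathIntegral f Z (lifetime Z ω) ω) with h1 | h1
  · exact Or.inl (h.exists_pathIntegral_eq hf h1)
  · exact Or.inr h1

section TimeChange

variable {Ω E : Type*} [TopologicalSpace E] [TopologicalSpace.PseudoMetrizableSpace E]
  [MeasurableSpace E] [BorelSpace E] {Z : ℝ≥0 → Ω → Adj E} {ω : Ω} {f : E → ℝ≥0∞}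

theorem IsRegularPath.timeChanged_ne_cemetery_iff (h : IsRegularPath fun t => Z t ω)
    (hf : IsClockWeight f) {t : ℝ≥0} :
    timeChanged f Z t ω ≠ cemetery ↔ t < pathIntegral f Z (lifetime Z ω) ω := by
  refine ⟨fun h1 => lt_of_not_ge fun h2 => h1 (timeChanged_eq_cemetery h2), fun h1 => ?_⟩
  obtain ⟨r, hr, h2⟩ := h.exists_pathIntegral_eq hf h1
  rwa [h.timeChanged_eq hf hr h2]

/-- All measurability statements about the time change go through this equivalence, which trades the
inverse clock for the clock itself. -/
theorem IsRegularPath.inverseClock_lt_iff (h : IsRegularPath fun t => Z t ω)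
    (hf : IsClockWeight f) {t u : ℝ≥0} :
    inverseClock f Z t ω < u ↔ t < pathIntegral f Z u ω := by
  rcases h.exists_or_dead hf t with ⟨r, hr, ht⟩ | ht
  · rw [h.inverseClock_eq hf hr ht, ← ht, h.pathIntegral_lt_iff hf hr, WithTop.coe_lt_coe,
      ENNReal.coe_lt_coe]
  · rw [inverseClock_eq_top ht]
    refine ⟨fun h1 => absurd h1 not_top_lt, fun h1 => absurd h1 (not_lt.2 (le_trans ?_ ht))⟩
    rw [h.pathIntegral_lifetime]
    exact pathIntegral_mono le_top

theorem IsRegularPath.timeChange (h : IsRegularPath fun t => Z t ω) (hf : IsClockWeight f) :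
    IsRegularPath fun t => timeChanged f Z t ω where
  absorbed s t hst hs := by
    by_contra h1
    have h2 := (h.timeChanged_ne_cemetery_iff hf).1 h1
    exact (h.timeChanged_ne_cemetery_iff hf).2
      ((ENNReal.coe_le_coe.2 hst).trans_lt h2) hs
  rightContinuous t := by
    rcases h.exists_or_dead hf t with ⟨r, hr, ht⟩ | ht
    · intro V hV
      simp only [h.timeChanged_eq hf hr ht] at hV
      obtain ⟨u, hu, hs⟩ := mem_nhdsGE_iff_exists_Ico_subset.1 (h.rightContinuous r hV)
      obtain ⟨v, hv, hv2⟩ := h.exists_alive hr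
      -- `u` bounds the interval on which the path stays in `V`, and `v` is a time at which it is
      -- still alive, so that the clock at the minimum is finite and below its final value.
      have hu' : r < min u v := lt_min hu hv
      have hv' : Z (min u v) ω ≠ cemetery := h.alive_mono (min_le_right _ _) hv2
      have h1 := h.pathIntegral_ne_top hf hv'
      have h2 := h.pathIntegral_lt hf hr (ENNReal.coe_lt_coe.2 hu')
      have h3 := h.pathIntegral_lt_lifetime hf hv'
      set c := pathIntegral f Z (min u v : ℝ≥0) ω with hc
      lift c to ℝ≥0 using h1 with c
      rw [ht, ENNReal.coe_lt_coe] at h2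
      refine mem_map.2 (mem_of_superset (Ico_mem_nhdsGE h2) fun s hsc => ?_)
      obtain ⟨q, hq, hq2⟩ := h.exists_pathIntegral_eq hf
        ((ENNReal.coe_lt_coe.2 hsc.2).trans h3)
      change timeChanged f Z s ω ∈ V
      rw [h.timeChanged_eq hf hq hq2]
      refine hs ⟨?_, ?_⟩
      · by_contra h4
        have := h.pathIntegral_lt hf hq (ENNReal.coe_lt_coe.2 (not_le.1 h4))
        rw [hq2, ht, ENNReal.coe_lt_coe] at this
        exact absurd hsc.1 (not_le.2 this)
      · refine lt_of_lt_of_le ?_ (min_le_left u v)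
        rw [← ENNReal.coe_lt_coe, ← h.pathIntegral_lt_iff hf hq, ← hc, hq2, ENNReal.coe_lt_coe]
        exact hsc.2
    · refine (continuousWithinAt_const (b := cemetery)).congr (fun s hs => ?_) ?_
      · exact timeChanged_eq_cemetery (ht.trans (ENNReal.coe_le_coe.2 hs))
      · exact timeChanged_eq_cemetery ht
  leftLimits t ht0 h0 := by
    obtain ⟨r, hr, ht⟩ := h.exists_pathIntegral_eq hf ((h.timeChanged_ne_cemetery_iff hf).1 h0)
    have hr0 : 0 < r := by
      rw [pos_iff_ne_zero]
      rintro rfl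
      rw [ENNReal.coe_zero, pathIntegral_zero] at ht
      exact ht0.ne (by exact_mod_cast ht)
    obtain ⟨l, hl⟩ := h.leftLimits r hr0 hr
    refine ⟨l, fun V hV => ?_⟩
    obtain ⟨q, hq, hs⟩ := (mem_nhdsLT_iff_exists_Ioo_subset' hr0).1 (hl hV)
    have hq' : Z q ω ≠ cemetery := h.alive_mono (le_of_lt hq) hr
    have h2 := h.pathIntegral_lt hf hq' (ENNReal.coe_lt_coe.2 hq)
    have h1 := h.pathIntegral_ne_top hf hq'
    set c := pathIntegral f Z (q : ℝ≥0) ω with hc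
    lift c to ℝ≥0 using h1 with c
    rw [ht, ENNReal.coe_lt_coe] at h2
    refine mem_map.2 (mem_of_superset (Ioo_mem_nhdsLT h2) fun s hsc => ?_)
    obtain ⟨p, hp, hp2⟩ := h.exists_pathIntegral_eq hf
      ((ENNReal.coe_lt_coe.2 hsc.2).trans ((h.timeChanged_ne_cemetery_iff hf).1 h0))
    change timeChanged f Z s ω ∈ V
    rw [h.timeChanged_eq hf hp hp2]
    refine hs ⟨?_, ?_⟩
    · rw [← ENNReal.coe_lt_coe, ← h.pathIntegral_lt_iff hf hq', ← hc, hp2, ENNReal.coe_lt_coe]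
      exact hsc.1
    · rw [← ENNReal.coe_lt_coe, ← h.pathIntegral_lt_iff hf hp, ht, hp2, ENNReal.coe_lt_coe]
      exact hsc.2

theorem IsRegularPath.lifetime_timeChanged (h : IsRegularPath fun t => Z t ω)
    (hf : IsClockWeight f) :
    lifetime (timeChanged f Z) ω = pathIntegral f Z (lifetime Z ω) ω := by
  have key : ∀ t : ℝ≥0, (t : ℝ≥0∞) < lifetime (timeChanged f Z) ω
      ↔ (t : ℝ≥0∞) < pathIntegral f Z (lifetime Z ω) ω := fun t =>
    (h.timeChange hf).lt_lifetime_iff.trans (h.timeChanged_ne_cemetery_iff hf)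
  exact le_antisymm (ENNReal.le_of_forall_nnreal_lt fun r hr => ((key r).1 hr).le)
    (ENNReal.le_of_forall_nnreal_lt fun r hr => ((key r).2 hr).le)

/-- The change of variables `dC_u = f(Z_u) du`, as an identity of measures; it suffices to compare
the masses of half-lines. -/
theorem IsRegularPath.map_clock (h : IsRegularPath fun t => Z t ω) (hf : IsClockWeight f)
    {r : ℝ≥0} (hr : Z r ω ≠ cemetery) :
    ((volume.withDensity fun u : ℝ => extendZero f (Z u.toNNReal ω)).restrict (Ico 0 (r : ℝ))).map
        (fun u : ℝ => (pathIntegral f Z u.toNNReal ω).toReal)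
      = volume.restrict (Ico 0 (pathIntegral f Z r ω).toReal) := by
  have hm : Measurable fun u : ℝ => (pathIntegral f Z u.toNNReal ω).toReal := by
    refine ENNReal.measurable_toReal.comp (Monotone.measurable fun u v huv => ?_)
    exact pathIntegral_mono (ENNReal.coe_le_coe.2 (Real.toNNReal_mono huv))
  have hr' := h.pathIntegral_ne_top hf hr
  -- The uniqueness criterion wants finiteness of the first measure, which is immediate for Lebesgue
  -- measure on a bounded interval.
  symm
  refine Measure.ext_of_Iic _ _ fun a => ?_
  rw [Measure.map_apply hm measurableSet_Iic, Measure.restrict_apply (hm measurableSet_Iic),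
    Measure.restrict_apply measurableSet_Iic]
  have hlt : ∀ u : ℝ, u < r → u.toNNReal ≤ r := fun u hu => by
    rw [Real.toNNReal_le_iff_le_coe]
    exact hu.le
  rcases lt_or_ge a 0 with ha | ha
  · rw [(_ : Iic a ∩ Ico 0 (pathIntegral f Z r ω).toReal = ∅),
      (_ : ((fun u : ℝ => (pathIntegral f Z u.toNNReal ω).toReal) ⁻¹' Iic a) ∩ Ico 0 (r : ℝ) = ∅)]
    · simp
    · refine eq_empty_of_forall_notMem fun u hu => ?_
      exact absurd (ENNReal.toReal_nonneg.trans hu.1) (not_le.2 ha)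
    · refine eq_empty_of_forall_notMem fun u hu => ?_
      exact absurd (hu.2.1.trans hu.1) (not_le.2 ha)
  rcases lt_or_ge (ENNReal.ofReal a) (pathIntegral f Z r ω) with hb | hb
  -- With `q` the time at which the clock shows `a`, the preimage of `[0, a]` is `[0, q]`, whose
  -- mass is the clock at `q`, that is `a`.
  · obtain ⟨q, hq, hq2⟩ := h.exists_pathIntegral_eq hf (hb.trans (h.pathIntegral_lt_lifetime hf hr))
    have hqr : q < r := by
      rwa [← ENNReal.coe_lt_coe, ← h.pathIntegral_lt_iff hf hq, hq2]
    rw [(_ : Iic a ∩ Ico 0 (pathIntegral f Z r ω).toReal = Icc 0 a),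
      (_ : ((fun u : ℝ => (pathIntegral f Z u.toNNReal ω).toReal) ⁻¹' Iic a) ∩ Ico 0 (r : ℝ)
        = Icc 0 (q : ℝ)), withDensity_apply _ measurableSet_Icc,
      setLIntegral_congr Ico_ae_eq_Icc.symm, ← pathIntegral_coe, hq2, Real.volume_Icc, sub_zero]
    · ext u
      simp only [mem_inter_iff, mem_preimage, mem_Iic, mem_Ico, mem_Icc]
      constructor
      · rintro ⟨h1, h2, h3⟩
        refine ⟨h2, le_of_not_gt fun h4 => ?_⟩
        have h5 := h.pathIntegral_lt hf (r := q) (s := u.toNNReal) hq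
          (ENNReal.coe_lt_coe.2 (Real.lt_toNNReal_iff_coe_lt.2 h4))
        rw [hq2, ENNReal.ofReal_lt_iff_lt_toReal ha
          (h.pathIntegral_ne_top hf (h.alive_mono (hlt u h3) hr))] at h5
        exact absurd h1 (not_le.2 h5)
      · rintro ⟨h1, h2⟩
        refine ⟨?_, h1, h2.trans_lt (by exact_mod_cast hqr)⟩
        refine ENNReal.toReal_le_of_le_ofReal ha ?_
        rw [← hq2]
        exact pathIntegral_mono (ENNReal.coe_le_coe.2 (Real.toNNReal_le_iff_le_coe.2 h2))
    · ext u
      simp only [mem_inter_iff, mem_Iic, mem_Ico, mem_Icc]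
      rw [ENNReal.ofReal_lt_iff_lt_toReal ha hr'] at hb
      constructor
      · rintro ⟨h1, h2, h3⟩
        exact ⟨h2, h1⟩
      · rintro ⟨h1, h2⟩
        exact ⟨h2, h1, h2.trans_lt hb⟩
  · have hb' : (pathIntegral f Z r ω).toReal ≤ a := ENNReal.toReal_le_of_le_ofReal ha hb
    rw [inter_eq_right.2 fun u hu => hu.2.le.trans hb', inter_eq_right.2 fun u hu => ?_,
      withDensity_apply _ measurableSet_Ico, ← pathIntegral_coe, Real.volume_Ico, sub_zero,
      ENNReal.ofReal_toReal hr']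
    refine le_trans (ENNReal.toReal_mono hr' ?_) hb'
    exact pathIntegral_mono (ENNReal.coe_le_coe.2 (hlt u hu.2))

theorem IsRegularPath.pathIntegral_timeChanged (h : IsRegularPath fun t => Z t ω)
    (hf : IsClockWeight f) {g : E → ℝ≥0∞} (hg : Measurable g) {r : ℝ≥0} (hr : Z r ω ≠ cemetery) :
    pathIntegral g (timeChanged f Z) (pathIntegral f Z r ω) ω
      = pathIntegral (fun x => f x * g x) Z r ω := by
  have hr' := h.pathIntegral_ne_top hf hr
  have hm : Measurable fun u : ℝ => (pathIntegral f Z u.toNNReal ω).toReal := by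
    refine ENNReal.measurable_toReal.comp (Monotone.measurable fun u v huv => ?_)
    exact pathIntegral_mono (ENNReal.coe_le_coe.2 (Real.toNNReal_mono huv))
  have h1 := (h.timeChange hf).measurable_rate hg
  have h3 : Measurable fun u : ℝ => extendZero g (timeChanged f Z
    (pathIntegral f Z u.toNNReal ω).toReal.toNNReal ω) := h1.comp hm
  conv_lhs => rw [← ENNReal.coe_toNNReal hr', pathIntegral_coe]
  change ∫⁻ u in Ico 0 (pathIntegral f Z r ω).toReal, _ = _
  rw [← h.map_clock hf hr, lintegral_map h1 hm, restrict_withDensity measurableSet_Ico,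
    lintegral_withDensity_eq_lintegral_mul _ (h.measurable_rate hf.measurable) h3,
    pathIntegral_coe]
  refine setLIntegral_congr_fun measurableSet_Ico fun u hu => ?_
  have hu' : Z u.toNNReal ω ≠ cemetery :=
    h.alive_mono (Real.toNNReal_le_iff_le_coe.2 hu.2.le) hr
  have h2 : timeChanged f Z (pathIntegral f Z u.toNNReal ω).toReal.toNNReal ω
      = Z u.toNNReal ω := by
    refine h.timeChanged_eq hf hu' ?_
    exact (ENNReal.ofReal_toReal (h.pathIntegral_ne_top hf hu')).symm
  simp only [Pi.mul_apply, h2]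
  rcases Z u.toNNReal ω with x | x
  · rfl
  · simp [extendZero]

theorem IsRegularPath.pathIntegral_inv_timeChanged (h : IsRegularPath fun t => Z t ω)
    (hf : IsClockWeight f) {r : ℝ≥0} (hr : Z r ω ≠ cemetery) :
    pathIntegral (fun x => (f x)⁻¹) (timeChanged f Z) (pathIntegral f Z r ω) ω = r := by
  rw [h.pathIntegral_timeChanged hf hf.inv.measurable hr, pathIntegral_coe,
    setLIntegral_congr_fun (g := fun _ => 1) measurableSet_Ico]
  · simp
  · intro u hu
    have hu' : Z u.toNNReal ω ≠ cemetery :=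
      h.alive_mono (Real.toNNReal_le_iff_le_coe.2 hu.2.le) hr
    rcases hz : Z u.toNNReal ω with x | x
    · simp [extendZero, ENNReal.mul_inv_cancel (hf.ne_zero x) (hf.ne_top x), hz]
    · exact absurd hz hu'

/-- The second clock, evaluated at the value of the first clock at `r`, returns `r`. A time at which
the original path is dead is never reached by the second clock while the new path is alive, so both
sides are then dead. -/
theorem IsRegularPath.timeChanged_inv_timeChanged (h : IsRegularPath fun t => Z t ω)
    (hf : IsClockWeight f) (t : ℝ≥0) :
    timeChanged (fun x => (f x)⁻¹) (timeChanged f Z) t ω = Z t ω := by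
  by_cases ht : Z t ω = cemetery
  · rw [ht]
    refine timeChanged_eq_cemetery (le_of_not_gt fun h1 => ?_)
    obtain ⟨s, hs, hst⟩ := (h.timeChange hf).exists_pathIntegral_eq hf.inv h1
    obtain ⟨r, hr, hrs⟩ := h.exists_pathIntegral_eq hf ((h.timeChanged_ne_cemetery_iff hf).1 hs)
    rw [← hrs, h.pathIntegral_inv_timeChanged hf hr, ENNReal.coe_inj] at hst
    exact hr (hst ▸ ht)
  · obtain ⟨c, hc⟩ : ∃ c : ℝ≥0, (c : ℝ≥0∞) = pathIntegral f Z t ω :=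
      ⟨_, ENNReal.coe_toNNReal (h.pathIntegral_ne_top hf ht)⟩
    have h1 := h.timeChanged_eq hf ht hc.symm
    rw [← h1]
    refine (h.timeChange hf).timeChanged_eq hf.inv (by rwa [h1]) ?_
    rw [hc, h.pathIntegral_inv_timeChanged hf ht]

/-- By additivity of the clock, once it shows `c` at time `r` it continues as the clock of the
shifted path. This is the pathwise core of the strong Markov property after the time change. -/
theorem IsRegularPath.timeChanged_add (h : IsRegularPath fun t => Z t ω)
    (hf : IsClockWeight f) {r c : ℝ≥0} (hc : pathIntegral f Z r ω = c)
    (s : ℝ≥0) :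
    timeChanged f Z (c + s) ω = timeChanged f (fun t => Z (r + t)) s ω := by
  rcases (h.shift r).exists_or_dead hf s with ⟨u, hu, hs⟩ | hs
  · rw [(h.shift r).timeChanged_eq hf hu hs]
    refine h.timeChanged_eq hf hu ?_
    rw [ENNReal.coe_add, pathIntegral_add, hc, hs, ENNReal.coe_add]
  · rw [timeChanged_eq_cemetery hs]
    refine timeChanged_eq_cemetery (le_of_not_gt fun h1 => ?_)
    obtain ⟨v, hv, hv2⟩ := h.exists_pathIntegral_eq hf h1
    have hrv : r ≤ v := by
      refine le_of_not_gt fun h2 => ?_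
      have h3 := h.pathIntegral_lt hf hv (ENNReal.coe_lt_coe.2 h2)
      rw [hv2, hc, ENNReal.coe_lt_coe] at h3
      exact absurd h3 (not_lt.2 le_self_add)
    obtain ⟨u, rfl⟩ := exists_add_of_le hrv
    rw [ENNReal.coe_add, pathIntegral_add, hc, ENNReal.coe_add] at hv2
    have h4 := (ENNReal.add_right_inj ENNReal.coe_ne_top).1 hv2
    exact absurd ((h.shift r).pathIntegral_lt_lifetime hf hv) (by rw [h4]; exact not_lt.2 hs)

end TimeChange

/-! ### Images of paths under a map of the state spaces and a linear change of time -/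

section Scaling

variable {Ω Ω' E E' : Type*} {Z : ℝ≥0 → Ω → Adj E} {ω : Ω} {W : ℝ≥0 → Ω' → Adj E'} {ω' : Ω'}
  {f : E → ℝ≥0∞} {f' : E' → ℝ≥0∞}
  {e : E → E'} {k : ℝ≥0}

theorem map_eq_cemetery_iff {x : Adj E} :
    Sum.map e id x = (cemetery : Adj E') ↔ x = cemetery := by
  rcases x with x | x <;> simp [Sum.map, cemetery]

theorem continuous_map [TopologicalSpace E] [TopologicalSpace E'] (he : Continuous e) :
    Continuous (Sum.map e id : Adj E → Adj E') := he.sumMap continuous_id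

theorem IsRegularPath.map [TopologicalSpace E] [TopologicalSpace E']
    (h : IsRegularPath fun t => Z t ω) (he : Continuous e) (hk : 0 < k) :
    IsRegularPath fun t => (Sum.map e id (Z (k * t) ω) : Adj E') where
  absorbed s t hst hs := by
    rw [map_eq_cemetery_iff] at hs ⊢
    exact h.absorbed _ _ (by gcongr) hs
  rightContinuous t := by
    refine (continuous_map he).continuousAt.comp_continuousWithinAt ?_
    exact (h.rightContinuous (k * t)).comp (f := fun s => k * s) (by fun_prop)
      fun s hs => mul_le_mul_right hs k
  leftLimits t ht hz := by
    obtain ⟨l, hl⟩ := h.leftLimits (k * t) (by positivity)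
      (fun h1 => hz (map_eq_cemetery_iff.2 h1))
    refine ⟨Sum.map e id l, ((continuous_map he).tendsto l).comp
      (hl.comp (tendsto_nhdsWithin_iff.2 ⟨?_, ?_⟩))⟩
    · exact (Continuous.tendsto (by fun_prop : Continuous fun s : ℝ≥0 => k * s) t).mono_left
        nhdsWithin_le_nhds
    · filter_upwards [self_mem_nhdsWithin] with s hs
      exact mul_lt_mul_of_pos_left hs hk

theorem pathIntegral_map (hk : 0 < k) {c : ℝ≥0∞} (hc : c ≠ ⊤) (hff : ∀ x, f' (e x) = c * f x)
    (hW : ∀ t, W t ω' = Sum.map e id (Z (k * t) ω)) (s : ℝ≥0) :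
    pathIntegral f' W s ω'
      = c / k * pathIntegral f Z (k * s : ℝ≥0) ω := by
  have h1 : ∀ x : Adj E, extendZero f' (Sum.map e id x) = c * extendZero f x := by
    rintro (x | x)
    · exact hff x
    · simp [extendZero]
  have hk' : (k : ℝ) ≠ 0 := by exact_mod_cast hk.ne'
  have h2 : (volume : Measure ℝ) = (k : ℝ≥0∞) • Measure.map (fun u => (k : ℝ) * u) volume := by
    have := Real.smul_map_volume_mul_left hk'
    rw [abs_of_pos (by exact_mod_cast hk), ENNReal.ofReal_coe_nnreal] at this
    exact this.symm
  have h3 : pathIntegral f Z (k * s : ℝ≥0) ω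
      = k * ∫⁻ u in Ico (0 : ℝ) s, extendZero f (Z (k * u.toNNReal) ω) := by
    have hpre : (fun u => (k : ℝ) * u) ⁻¹' Ico 0 ((k * s : ℝ≥0) : ℝ) = Ico 0 (s : ℝ) := by
      ext u
      have hk0 : (0 : ℝ) < k := by exact_mod_cast hk
      simp [mul_nonneg_iff_of_pos_left hk0, mul_lt_mul_iff_right₀ hk0]
    rw [pathIntegral_coe]
    conv_lhs => rw [h2]
    rw [Measure.restrict_smul, lintegral_smul_measure,
      (measurableEmbedding_mulLeft₀ hk').restrict_map,
      (measurableEmbedding_mulLeft₀ hk').lintegral_map, hpre, smul_eq_mul]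
    congr 1
    refine setLIntegral_congr_fun measurableSet_Ico fun u hu => ?_
    simp only [Real.toNNReal_mul k.coe_nonneg, Real.toNNReal_coe]
  rw [h3, ← mul_assoc, ENNReal.div_mul_cancel (by exact_mod_cast hk.ne') ENNReal.coe_ne_top,
    pathIntegral_coe, ← lintegral_const_mul' _ _ hc]
  exact lintegral_congr fun u => by rw [hW, h1]

/-- A speed factor `k` divides the clock by `k` and a weight factor `c` multiplies it by `c`, so the
two inverse clocks differ by the factor `k / c`. The cases used later are `k = c = 1`, for
inversion, `k = 1` and `c = a ^ α`, for self-similarity, and `k = c = a ^ (-α)`, for additivity. -/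
theorem IsRegularPath.timeChanged_map [TopologicalSpace E] [TopologicalSpace E']
    [TopologicalSpace.PseudoMetrizableSpace E] [MeasurableSpace E] [BorelSpace E]
    [TopologicalSpace.PseudoMetrizableSpace E'] [MeasurableSpace E'] [BorelSpace E']
    (h : IsRegularPath fun t => Z t ω) (hf : IsClockWeight f) (hf' : IsClockWeight f')
    (he : Continuous e) (hk : 0 < k) {c : ℝ≥0} (hc : 0 < c) (hff : ∀ x, f' (e x) = c * f x)
    (hW : ∀ t, W t ω' = Sum.map e id (Z (k * t) ω)) (t : ℝ≥0) :
    timeChanged f' W t ω'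
      = Sum.map e id (timeChanged f Z (k / c * t) ω) := by
  have h' : IsRegularPath fun t => W t ω' := by
    simp only [hW]
    exact h.map he hk
  have h0 : ∀ r, W r ω' = cemetery ↔ Z (k * r) ω = cemetery := fun r => by
    rw [hW, map_eq_cemetery_iff]
  have key : ∀ r s : ℝ≥0, pathIntegral f' W r ω' = s
      ↔ pathIntegral f Z (k * r : ℝ≥0) ω = (k / c * s : ℝ≥0) := fun r s => by
    rw [pathIntegral_map hk ENNReal.coe_ne_top hff hW, ← ENNReal.coe_div hk.ne']
    have h2 : s = c / k * (k / c * s) := by field_simp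
    conv_lhs => rw [h2, ENNReal.coe_mul (c / k)]
    rw [ENNReal.mul_right_inj (by exact_mod_cast (div_pos hc hk).ne') ENNReal.coe_ne_top]
  rcases h'.exists_or_dead hf' t with ⟨r, hr, ht⟩ | ht
  · rw [h'.timeChanged_eq hf' hr ht, h.timeChanged_eq hf (fun h1 => hr ((h0 r).2 h1))
      ((key r t).1 ht), hW]
  · rw [timeChanged_eq_cemetery ht, eq_comm, map_eq_cemetery_iff]
    refine timeChanged_eq_cemetery (le_of_not_gt fun h1 => ?_)
    obtain ⟨r, hr, hrt⟩ := h.exists_pathIntegral_eq hf h1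
    have hkr : k * (r / k) = r := by field_simp
    rw [← hkr] at hr hrt
    have h2 := h'.pathIntegral_lt_lifetime hf' (r := r / k) fun h3 =>
      hr ((h0 _).1 h3)
    rw [(key _ _).2 hrt] at h2
    exact absurd h2 (not_lt.2 ht)

end Scaling

/-! ### Measurability of the time change -/

theorem timeChanged_eq_ite {Ω E : Type*} (f : E → ℝ≥0∞) (Z : ℝ≥0 → Ω → Adj E) (t : ℝ≥0) (ω : Ω)
    [Decidable (inverseClock f Z t ω = ⊤)] :
    timeChanged f Z t ω = if inverseClock f Z t ω = ⊤ then cemetery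
      else Z ((inverseClock f Z t ω).untopD 0) ω := by
  rw [timeChanged]
  split_ifs with h1 h2 h2
  · rw [inverseClock, if_pos h1] at h2
    exact absurd h2 (WithTop.coe_ne_top)
  · rw [inverseClock, if_pos h1]
    rfl
  · rfl
  · rw [inverseClock, if_neg h1] at h2
    exact absurd rfl h2

theorem continuousWithinAt_min {E : Type*} [TopologicalSpace E] {w : ℝ≥0 → Adj E}
    (h : ∀ t, ContinuousWithinAt w (Ici t) t)
    (u t : ℝ≥0) : ContinuousWithinAt (fun s => w (min s u)) (Ici t) t :=
  (h (min t u)).comp (f := fun s => min s u) (by fun_prop)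
    fun s hs => show min t u ≤ min s u from min_le_min_right u hs

theorem not_top_lt_coe (u : ℝ≥0) : ¬ (⊤ : WithTop ℝ≥0) < (u : WithTop ℝ≥0) := not_top_lt

section Measurability

variable {Ω E : Type*} {mΩ : MeasurableSpace Ω} [TopologicalSpace E]
  [TopologicalSpace.PseudoMetrizableSpace E] [MeasurableSpace E] [BorelSpace E]
  {Z : ℝ≥0 → Ω → Adj E} {f : E → ℝ≥0∞}

theorem measurable_pathIntegral (hZ : ∀ t, Measurable (Z t))
    (hr : ∀ ω t, ContinuousWithinAt (fun s => Z s ω) (Ici t) t) (hf : Measurable f) (s : ℝ≥0∞) :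
    Measurable (pathIntegral f Z s) := by
  have h1 : Measurable fun p : Ω × ℝ => extendZero f (Z p.2.toNNReal p.1) :=
    (measurable_extendZero hf).comp ((measurable_uncurry_of_rightContinuous hZ hr).comp
      ((measurable_real_toNNReal.comp measurable_snd).prodMk measurable_fst))
  exact h1.lintegral_prod_right'

theorem measurable_inverseClock (hZ : ∀ t, Measurable (Z t))
    (h : ∀ ω, IsRegularPath fun t => Z t ω) (hf : IsClockWeight f) (t : ℝ≥0) :
    Measurable (inverseClock f Z t) := by
  have hm := measurable_pathIntegral hZ (fun ω => (h ω).rightContinuous) hf.measurable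
  refine measurable_of_Iio fun x => ?_
  cases x with
  | top =>
    have : inverseClock f Z t ⁻¹' Iio ⊤ = {ω | (t : ℝ≥0∞) < pathIntegral f Z ⊤ ω} := by
      ext ω
      rw [mem_preimage, mem_Iio, mem_ofPred_eq, ← (h ω).pathIntegral_lifetime, inverseClock]
      split_ifs with h1
      · exact ⟨fun _ => h1, fun _ => WithTop.coe_lt_top _⟩
      · exact ⟨fun h2 => absurd h2 (lt_irrefl _), fun h2 => absurd h2 h1⟩
    rw [this]
    exact measurableSet_lt measurable_const (hm _)
  | coe u =>
    have : inverseClock f Z t ⁻¹' Iio (u : WithTop ℝ≥0)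
        = {ω | (t : ℝ≥0∞) < pathIntegral f Z u ω} := by
      ext ω
      exact (h ω).inverseClock_lt_iff hf
    rw [this]
    exact measurableSet_lt measurable_const (hm _)

theorem measurable_eval_time (hZ : ∀ t, Measurable (Z t))
    (hr : ∀ ω t, ContinuousWithinAt (fun s => Z s ω) (Ici t) t) {T : Ω → WithTop ℝ≥0}
    (hT : Measurable T) : Measurable fun ω => Z ((T ω).untopD 0) ω :=
  (measurable_uncurry_of_rightContinuous hZ hr).comp ((hT.untopD 0).prodMk measurable_id)

theorem measurable_timeChanged (hZ : ∀ t, Measurable (Z t))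
    (h : ∀ ω, IsRegularPath fun t => Z t ω) (hf : IsClockWeight f) (t : ℝ≥0) :
    Measurable (timeChanged f Z t) := by
  classical
  have h1 := measurable_inverseClock hZ h hf t
  have h2 : timeChanged f Z t = fun ω => if inverseClock f Z t ω = ⊤ then cemetery
      else Z ((inverseClock f Z t ω).untopD 0) ω := funext fun ω => timeChanged_eq_ite f Z t ω
  rw [h2]
  exact Measurable.ite (h1 (measurableSet_singleton ⊤)) measurable_const
    (measurable_eval_time hZ (fun ω => (h ω).rightContinuous) h1)

theorem inverseClock_mono {ω : Ω} (h : IsRegularPath fun t => Z t ω) (hf : IsClockWeight f)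
    {s t : ℝ≥0} (hst : s ≤ t) : inverseClock f Z s ω ≤ inverseClock f Z t ω := by
  refine le_of_not_gt fun h1 => ?_
  obtain ⟨u, hu⟩ := WithTop.ne_top_iff_exists.1 h1.ne_top
  rw [← hu] at h1
  obtain ⟨v, hv, hv2⟩ : ∃ v : ℝ≥0, u < v ∧ (v : WithTop ℝ≥0) ≤ inverseClock f Z s ω := by
    cases hi : inverseClock f Z s ω with
    | top => exact ⟨u + 1, by simp, le_top⟩
    | coe v => exact ⟨v, by rw [hi] at h1; exact WithTop.coe_lt_coe.1 h1, le_rfl⟩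
  have h2 : inverseClock f Z t ω < v := by rw [← hu]; exact WithTop.coe_lt_coe.2 hv
  rw [h.inverseClock_lt_iff hf] at h2
  have h3 := (h.inverseClock_lt_iff hf (t := s)).2 ((ENNReal.coe_le_coe.2 hst).trans_lt h2)
  exact absurd h3 (not_lt.2 hv2)

theorem measurable_pathIntegral_filtration {𝓕 : Filtration ℝ≥0 mΩ} (hZ : ∀ t, Measurable[𝓕 t] (Z t))
    (hr : ∀ ω t, ContinuousWithinAt (fun s => Z s ω) (Ici t) t) (hf : Measurable f) (u : ℝ≥0) :
    Measurable[𝓕 u] (pathIntegral f Z u) := by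
  -- The integral up to `u` sees the path only before `u`. Freezing the process at `u` makes all its
  -- values `𝓕 u`-measurable without changing the integral.
  have h1 : Measurable[𝓕 u] (pathIntegral f (fun s ω => Z (min s u) ω) u) :=
    measurable_pathIntegral (mΩ := 𝓕 u)
      (fun t => (hZ _).mono (𝓕.mono (min_le_right t u)) le_rfl)
      (fun ω t => continuousWithinAt_min (hr ω) u t) hf u
  convert h1 using 1
  funext ω
  rw [pathIntegral_coe, pathIntegral_coe]
  refine setLIntegral_congr_fun measurableSet_Ico fun v hv => ?_
  simp only [min_eq_left (Real.toNNReal_le_iff_le_coe.2 hv.2.le)]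

/-- The random time `τ_T` of the original time scale which corresponds to the random time `T`. -/
noncomputable def originalTime (f : E → ℝ≥0∞) (Z : ℝ≥0 → Ω → Adj E) (T : Ω → WithTop ℝ≥0) (ω : Ω) :
    WithTop ℝ≥0 :=
  open Classical in if T ω = ⊤ then ⊤ else inverseClock f Z ((T ω).untopD 0) ω

theorem inter_originalTime_lt (h : ∀ ω, IsRegularPath fun t => Z t ω) (hf : IsClockWeight f)
    {T : Ω → WithTop ℝ≥0} (A : Set Ω) (u : ℝ≥0) :
    A ∩ {ω | originalTime f Z T ω < u}
      = ⋃ n : ℕ, (A ∩ {ω | T ω < TopologicalSpace.denseSeq ℝ≥0 n})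
        ∩ {ω | inverseClock f Z (TopologicalSpace.denseSeq ℝ≥0 n) ω < u} := by
  ext ω
  simp only [mem_inter_iff, mem_iUnion, mem_ofPred_eq, (h ω).inverseClock_lt_iff hf, originalTime]
  cases hT : T ω with
  | top =>
    simp only [if_true, not_top_lt_coe, and_false, false_and, exists_false]
  | coe t =>
    simp only [WithTop.coe_ne_top, if_false, WithTop.untopD_coe, (h ω).inverseClock_lt_iff hf,
      WithTop.coe_lt_coe]
    constructor
    · rintro ⟨h1, h2⟩
      -- The clock may be infinite at `u`, so a finite number is inserted below it before the dense
      -- sequence is used.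
      obtain ⟨y, hy1, hy2⟩ := ENNReal.lt_iff_exists_nnreal_btwn.1 h2
      obtain ⟨_, ⟨n, rfl⟩, hq1, hq2⟩ := (TopologicalSpace.denseRange_denseSeq ℝ≥0).exists_between
        (ENNReal.coe_lt_coe.1 hy1)
      exact ⟨n, ⟨h1, hq1⟩, (ENNReal.coe_lt_coe.2 hq2).trans hy2⟩
    · rintro ⟨n, ⟨h1, h2⟩, h3⟩
      exact ⟨h1, (ENNReal.coe_lt_coe.2 h2).trans h3⟩

end Measurability

/-! ### Stopping times and the time-changed filtration -/

section Filtration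

variable {Ω E : Type*} {m : MeasurableSpace Ω} [TopologicalSpace E]
  [TopologicalSpace.PseudoMetrizableSpace E] [MeasurableSpace E] [BorelSpace E]
  {Z : ℝ≥0 → Ω → Adj E} {f : E → ℝ≥0∞} {𝓕 : Filtration ℝ≥0 m}

theorem isStronglyProgressive [SecondCountableTopology E] (hZ : ∀ t, Measurable[𝓕 t] (Z t))
    (hr : ∀ ω t, ContinuousWithinAt (fun s => Z s ω) (Ici t) t) :
    IsStronglyProgressive 𝓕 Z := fun i => by
  have h1 : Measurable[NNReal.measurableSpace.prod (𝓕 i)] fun p : ℝ≥0 × Ω => Z (min p.1 i) p.2 :=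
    measurable_uncurry_of_rightContinuous (mΩ := 𝓕 i) (Z := fun s ω => Z (min s i) ω)
      (fun t => (hZ _).mono (𝓕.mono (min_le_right t i)) le_rfl)
      (fun ω t => continuousWithinAt_min (hr ω) i t)
  have h2 : @Measurable _ _ (Subtype.instMeasurableSpace.prod (𝓕 i))
      (NNReal.measurableSpace.prod (𝓕 i)) fun p : Iic i × Ω => ((p.1 : ℝ≥0), p.2) :=
    Measurable.prodMk (measurable_subtype_coe.comp measurable_fst) measurable_snd
  have h3 : (fun p : Iic i × Ω => Z p.1 p.2) = fun p : Iic i × Ω => Z (min p.1 i) p.2 :=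
    funext fun p => by rw [min_eq_left (show (p.1 : ℝ≥0) ≤ i from p.1.2)]
  rw [h3]
  exact Measurable.stronglyMeasurable (mα := Subtype.instMeasurableSpace.prod (𝓕 i)) (h1.comp h2)

/-- The process at a stopping time is measurable with respect to the past of this time. -/
theorem measurable_eval_stoppingTime [SecondCountableTopology E]
    (hZ : ∀ t, Measurable[𝓕 t] (Z t))
    (hr : ∀ ω t, ContinuousWithinAt (fun s => Z s ω) (Ici t) t) {T : Ω → WithTop ℝ≥0}
    (hT : IsStoppingTime 𝓕 T) :
    Measurable[hT.measurableSpace] fun ω => Z ((T ω).untopD 0) ω := fun B hB => by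
  refine ⟨?_, fun i => ?_⟩
  · have h1 : ∀ t, Measurable[⨆ t, 𝓕 t] (Z t) := fun t => (hZ t).mono (le_iSup 𝓕 t) le_rfl
    exact measurable_eval_time h1 hr hT.measurable_iSup hB
  · have h1 := measurableSet_preimage_stoppedValue_inter (isStronglyProgressive hZ hr) hT hB i
    convert h1 using 1
    ext ω
    refine and_congr_left fun h2 => ?_
    obtain ⟨r, hr⟩ := WithTop.ne_top_iff_exists.1 (h2.trans_lt (WithTop.coe_lt_top i)).ne
    rw [mem_preimage, mem_preimage, stoppedValue, ← hr]
    rfl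

theorem isStoppingTime_inverseClock [𝓕.IsRightContinuous] (hZ : ∀ t, Measurable[𝓕 t] (Z t))
    (h : ∀ ω, IsRegularPath fun t => Z t ω) (hf : IsClockWeight f) (t : ℝ≥0) :
    IsStoppingTime 𝓕 (inverseClock f Z t) := by
  refine isStoppingTime_of_measurableSet_lt_of_isRightContinuous fun u => ?_
  simp only [(h _).inverseClock_lt_iff hf]
  exact measurableSet_lt measurable_const
    (measurable_pathIntegral_filtration hZ (fun ω => (h ω).rightContinuous) hf.measurable u)

/-- In a right continuous filtration, membership in `𝓕_T` can be tested on the events `T < u`. -/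
theorem measurableSet_of_inter_lt [𝓕.IsRightContinuous] {T : Ω → WithTop ℝ≥0}
    (hT : IsStoppingTime 𝓕 T) {A : Set Ω} (h0 : MeasurableSet[⨆ t, 𝓕 t] A)
    (hA : ∀ u : ℝ≥0, MeasurableSet[𝓕 u] (A ∩ {ω | T ω < u})) :
    MeasurableSet[hT.measurableSpace] A := by
  classical
  refine ⟨h0, ?_⟩
  -- Sending `T` to `∞` outside `A` encodes the event in a random time. Right continuity of the
  -- filtration then lets strict inequalities decide that it is a stopping time.
  have h1 : IsStoppingTime 𝓕 fun ω => if ω ∈ A then T ω else ⊤ := by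
    refine isStoppingTime_of_measurableSet_lt_of_isRightContinuous fun u => ?_
    convert hA u using 1
    ext ω
    by_cases h : ω ∈ A
    · simp [h]
    · simp only [h, false_and, mem_inter_iff, mem_ofPred_eq, if_false, not_top_lt_coe]
  intro u
  convert h1 u using 1
  ext ω
  by_cases h : ω ∈ A
  · simp [h]
  · simp only [h, false_and, mem_inter_iff, mem_ofPred_eq, if_false, false_iff]
    exact (WithTop.coe_lt_top u).not_ge

theorem inter_lt_measurableSet {T : Ω → WithTop ℝ≥0} (hT : IsStoppingTime 𝓕 T) {A : Set Ω}
    (hA : MeasurableSet[hT.measurableSpace] A) (u : ℝ≥0) :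
    MeasurableSet[𝓕 u] (A ∩ {ω | T ω < u}) := by
  convert (hA.2 u).inter (hT.measurableSet_lt u) using 1
  ext ω
  simp only [mem_inter_iff, mem_ofPred_eq, and_assoc]
  exact and_congr_right fun _ => ⟨fun h => ⟨h.le, h⟩, fun h => h.2⟩

/-- The time-changed filtration `𝓕_{τ_t}`. -/
noncomputable def timeChangedFiltration [𝓕.IsRightContinuous] (hZ : ∀ t, Measurable[𝓕 t] (Z t))
    (h : ∀ ω, IsRegularPath fun t => Z t ω) (hf : IsClockWeight f) : Filtration ℝ≥0 m where
  seq t := (isStoppingTime_inverseClock hZ h hf t).measurableSpace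
  mono' _ _ hst := IsStoppingTime.measurableSpace_mono _ _ fun ω => inverseClock_mono (h ω) hf hst
  le' _ := IsStoppingTime.measurableSpace_le _

variable [𝓕.IsRightContinuous] (hZ : ∀ t, Measurable[𝓕 t] (Z t))
    (h : ∀ ω, IsRegularPath fun t => Z t ω) (hf : IsClockWeight f)

theorem isRightContinuous_timeChangedFiltration :
    (timeChangedFiltration hZ h hf).IsRightContinuous where
  RC t A hA := by
    rw [Filtration.rightCont_eq] at hA
    have hA' : ∀ j > t, MeasurableSet[timeChangedFiltration hZ h hf j] A := by
      simpa only [MeasurableSpace.measurableSet_iInf] using hA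
    refine measurableSet_of_inter_lt (isStoppingTime_inverseClock hZ h hf t)
      (hA' (t + 1) (by simp)).1 fun u => ?_
    -- Since `τ_t < u` says `t < C_u`, which is an open condition on `t`, it persists for some `t +
    -- 1 / (n + 1)`.
    have h1 : A ∩ {ω | inverseClock f Z t ω < u}
        = ⋃ n : ℕ, A ∩ {ω | inverseClock f Z (t + 1 / (n + 1)) ω < u} := by
      ext ω
      simp only [mem_inter_iff, mem_iUnion, mem_ofPred_eq, (h ω).inverseClock_lt_iff hf]
      constructor
      · rintro ⟨h1, h2⟩
        have h3 : Tendsto (fun n : ℕ => ((t + 1 / ((n : ℝ≥0) + 1) : ℝ≥0) : ℝ≥0∞)) atTop (𝓝 t) := by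
          refine (ENNReal.continuous_coe.tendsto t).comp ?_
          simpa using tendsto_const_nhds (x := t).add
            (tendsto_one_div_add_atTop_nhds_zero_nat (𝕜 := ℝ≥0))
        obtain ⟨n, hn⟩ := (h3.eventually (gt_mem_nhds h2)).exists
        exact ⟨n, h1, hn⟩
      · rintro ⟨n, h1, h2⟩
        exact ⟨h1, (ENNReal.coe_le_coe.2 le_self_add).trans_lt h2⟩
    rw [h1]
    refine MeasurableSet.iUnion fun n => inter_lt_measurableSet
      (isStoppingTime_inverseClock hZ h hf (t + 1 / (n + 1))) (hA' _ ?_) u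
    exact lt_add_of_pos_right t (by positivity)

theorem measurableSet_inter_originalTime_lt {T : Ω → WithTop ℝ≥0}
    (hT : IsStoppingTime (timeChangedFiltration hZ h hf) T) {A : Set Ω}
    (hA : MeasurableSet[hT.measurableSpace] A) (u : ℝ≥0) :
    MeasurableSet[𝓕 u] (A ∩ {ω | originalTime f Z T ω < u}) := by
  rw [inter_originalTime_lt h hf]
  exact MeasurableSet.iUnion fun n => inter_lt_measurableSet
    (isStoppingTime_inverseClock hZ h hf _) (inter_lt_measurableSet hT hA _) u

theorem isStoppingTime_originalTime {T : Ω → WithTop ℝ≥0}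
    (hT : IsStoppingTime (timeChangedFiltration hZ h hf) T) :
    IsStoppingTime 𝓕 (originalTime f Z T) := by
  refine isStoppingTime_of_measurableSet_lt_of_isRightContinuous fun u => ?_
  have h1 := measurableSet_inter_originalTime_lt hZ h hf hT
    (@MeasurableSet.univ _ hT.measurableSpace) u
  rwa [univ_inter] at h1

/-- An event known at `T` in the new time scale is known at `τ_T` in the old one, so the strong
Markov property at `τ_T` applies to it. -/
theorem measurableSpace_le_originalTime {T : Ω → WithTop ℝ≥0}
    (hT : IsStoppingTime (timeChangedFiltration hZ h hf) T) :
    hT.measurableSpace ≤ (isStoppingTime_originalTime hZ h hf hT).measurableSpace := fun A hA =>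
  measurableSet_of_inter_lt _
    ((iSup_le fun t => (isStoppingTime_inverseClock hZ h hf t).measurableSpace_le') A hA.1)
    fun u => measurableSet_inter_originalTime_lt hZ h hf hT hA u

end Filtration

/-! ### The strong Markov property for events of the whole path -/

theorem top_add_coe (c : ℝ≥0) : (⊤ : WithTop ℝ≥0) + (c : WithTop ℝ≥0) = ⊤ := rfl

theorem not_top_le_coe (c : ℝ≥0) : ¬ (⊤ : WithTop ℝ≥0) ≤ (c : WithTop ℝ≥0) :=
  (WithTop.coe_lt_top c).not_ge

theorem isStoppingTime_add_const {Ω : Type*} {m : MeasurableSpace Ω} {𝓕 : Filtration ℝ≥0 m}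
    {T : Ω → WithTop ℝ≥0} (hT : IsStoppingTime 𝓕 T) (c : ℝ≥0) :
    IsStoppingTime 𝓕 fun ω => T ω + c := fun i => by
  rcases le_or_gt c i with hc | hc
  · have : {ω | T ω + c ≤ (i : WithTop ℝ≥0)} = {ω | T ω ≤ ((i - c : ℝ≥0) : WithTop ℝ≥0)} := by
      ext ω
      rw [mem_ofPred_eq, mem_ofPred_eq]
      cases T ω with
      | top => simp only [top_add_coe, not_top_le_coe]
      | coe t => rw [← WithTop.coe_add, WithTop.coe_le_coe, WithTop.coe_le_coe, le_tsub_iff_right hc]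
    rw [this]
    exact 𝓕.mono tsub_le_self _ (hT _)
  · have : {ω | T ω + c ≤ (i : WithTop ℝ≥0)} = ∅ := by
      refine eq_empty_of_forall_notMem fun ω hω => ?_
      rw [mem_ofPred_eq] at hω
      cases hT : T ω with
      | top => exact not_top_le_coe i (by rwa [hT, top_add_coe] at hω)
      | coe t =>
        rw [hT, ← WithTop.coe_add, WithTop.coe_le_coe] at hω
        exact absurd (hc.trans_le (le_add_self.trans hω)) (lt_irrefl _)
    rw [this]
    exact @MeasurableSet.empty _ (𝓕 i)

theorem untopD_add_const {T : WithTop ℝ≥0} (hT : T ≠ ⊤) (c : ℝ≥0) :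
    (T + c).untopD 0 = T.untopD 0 + c := by
  lift T to ℝ≥0 using hT
  rfl

theorem measurable_path {Ω E : Type*} [MeasurableSpace Ω] [MeasurableSpace E]
    {Z : ℝ≥0 → Ω → Adj E} (hZ : ∀ t, Measurable (Z t)) :
    Measurable fun ω t => Z t ω := measurable_pi_lambda _ hZ

section StandardProcess

variable {Ω E : Type*} {m : MeasurableSpace Ω} [TopologicalSpace E] [T2Space E]
  [LocallyCompactSpace E] [SecondCountableTopology E] [MeasurableSpace E] [BorelSpace E]
  {𝓕 : Filtration ℝ≥0 m} {P : Adj E → Measure Ω} {Z : ℝ≥0 → Ω → Adj E}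

theorem IsStandardProcess.regular (h : IsStandardProcess 𝓕 P Z) (ω : Ω) :
    IsRegularPath fun t => Z t ω where
  absorbed _ t hst hs := h.absorbed ω t ((lifetime_le hs).trans (ENNReal.coe_le_coe.2 hst))
  rightContinuous t := h.rightContinuous ω t
  leftLimits t ht hz := h.leftLimits ω t ht (lt_of_not_ge fun h1 => hz (h.absorbed ω t h1))

theorem IsStandardProcess.measurable (h : IsStandardProcess 𝓕 P Z) (t : ℝ≥0) :
    Measurable (Z t) := (h.adapted t).mono (𝓕.le t) le_rfl

theorem IsStandardProcess.measurable_eval (h : IsStandardProcess 𝓕 P Z) {T : Ω → WithTop ℝ≥0}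
    (hT : IsStoppingTime 𝓕 T) : Measurable fun ω => Z ((T ω).untopD 0) ω :=
  measurable_eval_time h.measurable h.rightContinuous hT.measurable'

theorem IsStandardProcess.measurable_eval_add (h : IsStandardProcess 𝓕 P Z) {T : Ω → WithTop ℝ≥0}
    (hT : IsStoppingTime 𝓕 T) (s : ℝ≥0) : Measurable fun ω => Z ((T ω).untopD 0 + s) ω :=
  (measurable_uncurry_of_rightContinuous h.measurable h.rightContinuous).comp
    (((hT.measurable'.untopD 0).add_const s).prodMk measurable_id)

theorem IsStandardProcess.measurable_map (h : IsStandardProcess 𝓕 P Z) (t : ℝ≥0) :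
    Measurable fun x => (P x).map (Z t) := by
  refine Measure.measurable_of_measurable_coe _ fun B hB => ?_
  simp only [Measure.map_apply (h.measurable t) hB]
  exact h.measurable_transition t B hB

theorem IsStandardProcess.measurable_lintegral (h : IsStandardProcess 𝓕 P Z) (t : ℝ≥0)
    {G : Adj E → ℝ≥0∞} (hG : Measurable G) : Measurable fun x => ∫⁻ ω, G (Z t ω) ∂(P x) := by
  simp only [← lintegral_map hG (h.measurable t)]
  exact (Measure.measurable_lintegral hG).comp (h.measurable_map t)

theorem IsStandardProcess.strongMarkov_lintegral (h : IsStandardProcess 𝓕 P Z) (x : Adj E)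
    {T : Ω → WithTop ℝ≥0} (hT : IsStoppingTime 𝓕 T) (s : ℝ≥0) {A : Set Ω}
    (hA : MeasurableSet[hT.measurableSpace] A) {G : Adj E → ℝ≥0∞} (hG : Measurable G) :
    ∫⁻ ω in A ∩ {ω | T ω ≠ ⊤}, G (Z ((T ω).untopD 0 + s) ω) ∂(P x)
      = ∫⁻ ω in A ∩ {ω | T ω ≠ ⊤}, ∫⁻ ω', G (Z s ω') ∂(P (Z ((T ω).untopD 0) ω)) ∂(P x) := by
  have hA' : MeasurableSet (A ∩ {ω | T ω ≠ ⊤}) :=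
    (hT.measurableSpace_le A hA).inter hT.measurableSet_eq_top.compl
  have hm : Measurable fun ω => (P (Z ((T ω).untopD 0) ω)).map (Z s) :=
    (h.measurable_map s).comp (h.measurable_eval hT)
  -- The strong Markov property for sets says that two measures coincide: the image law of the state
  -- after `T` and the mixture of transition laws. Integrating a function against both gives the
  -- claim.
  have h1 : ((P x).restrict (A ∩ {ω | T ω ≠ ⊤})).map (fun ω => Z ((T ω).untopD 0 + s) ω)
      = ((P x).restrict (A ∩ {ω | T ω ≠ ⊤})).bind
        (fun ω => (P (Z ((T ω).untopD 0) ω)).map (Z s)) := by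
    ext B hB
    rw [Measure.map_apply (h.measurable_eval_add hT s) hB,
      Measure.restrict_apply (h.measurable_eval_add hT s hB),
      Measure.bind_apply hB hm.aemeasurable,
      inter_comm]
    simp only [Measure.map_apply (h.measurable s) hB]
    exact h.strongMarkov x T hT s A hA B hB
  rw [← lintegral_map hG (h.measurable_eval_add hT s), h1, Measure.lintegral_bind
    hm.aemeasurable hG.aemeasurable]
  simp only [lintegral_map hG (h.measurable s)]

/-- The earliest time is split off and the others are measured from it; this is the induction step
for finite-dimensional laws. -/
theorem forall_mem_iff_min' {β : Type*} {I : Finset ℝ≥0} (hI : I.Nonempty) (w : ℝ≥0 → β)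
    (B : ℝ≥0 → Set β) :
    (∀ i ∈ I, w i ∈ B i) ↔ w (I.min' hI) ∈ B (I.min' hI) ∧
      ∀ j ∈ (I.erase (I.min' hI)).image (· - I.min' hI),
        w (I.min' hI + j) ∈ B (I.min' hI + j) := by
  constructor
  · refine fun h => ⟨h _ (I.min'_mem hI), fun j hj => ?_⟩
    obtain ⟨i, hi, rfl⟩ := Finset.mem_image.1 hj
    have hi' := Finset.mem_of_mem_erase hi
    rw [add_tsub_cancel_of_le (I.min'_le i hi')]
    exact h i hi'
  · rintro ⟨h1, h2⟩ i hi
    by_cases h3 : i = I.min' hI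
    · rwa [h3]
    · have h4 := h2 (i - I.min' hI) (Finset.mem_image.2 ⟨i, Finset.mem_erase.2 ⟨h3, hi⟩, rfl⟩)
      rwa [add_tsub_cancel_of_le (I.min'_le i hi)] at h4

theorem card_image_erase_min'_lt {I : Finset ℝ≥0} (hI : I.Nonempty) :
    ((I.erase (I.min' hI)).image (· - I.min' hI)).card < I.card :=
  Finset.card_image_le.trans_lt (Finset.card_erase_lt_of_mem (I.min'_mem hI))

/-- The law of the process at finitely many times, from the first of these times on, if the strong
Markov property is known for the other times. -/
theorem IsStandardProcess.cylinder_eq_of_strongMarkov (h : IsStandardProcess 𝓕 P Z)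
    {J : Finset ℝ≥0} {t : ℝ≥0} {B : ℝ≥0 → Set (Adj E)} (hB : ∀ i, MeasurableSet (B i))
    (hJ : ∀ (x : Adj E) (T : Ω → WithTop ℝ≥0) (hT : IsStoppingTime 𝓕 T) (A : Set Ω),
      MeasurableSet[hT.measurableSpace] A →
      P x (A ∩ {ω | T ω ≠ ⊤} ∩ {ω | ∀ j ∈ J, Z ((T ω).untopD 0 + j) ω ∈ B (t + j)})
        = ∫⁻ ω in A ∩ {ω | T ω ≠ ⊤},
          P (Z ((T ω).untopD 0) ω) {ω' | ∀ j ∈ J, Z j ω' ∈ B (t + j)} ∂(P x)) (x : Adj E) :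
    P x {ω | Z t ω ∈ B t ∧ ∀ j ∈ J, Z (t + j) ω ∈ B (t + j)}
      = ∫⁻ ω, (B t).indicator (fun y => P y {ω' | ∀ j ∈ J, Z j ω' ∈ B (t + j)}) (Z t ω) ∂(P x) := by
  have h1 := hJ x _ (isStoppingTime_const 𝓕 t) {ω | Z t ω ∈ B t} (by
    rw [IsStoppingTime.measurableSpace_const]
    exact h.adapted t (hB t))
  have h2 : {ω : Ω | (t : WithTop ℝ≥0) ≠ ⊤} = univ := by
    ext
    simp only [ne_eq, WithTop.coe_ne_top, not_false_eq_true, mem_ofPred_eq, mem_univ]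
  have h3 : MeasurableSet {ω | Z t ω ∈ B t} := h.measurable t (hB t)
  rw [h2, inter_univ, ← lintegral_indicator h3] at h1
  exact h1

/-- Measurability in the starting point and the strong Markov property at several times are proved
in one induction, because each step integrates the probability of the remaining cylinder as a
function of the state at the earliest time. -/
theorem IsStandardProcess.cylinder (h : IsStandardProcess 𝓕 P Z) (n : ℕ) :
    ∀ I : Finset ℝ≥0, I.card ≤ n → ∀ B : ℝ≥0 → Set (Adj E), (∀ i, MeasurableSet (B i)) →
    (Measurable fun x => P x {ω | ∀ i ∈ I, Z i ω ∈ B i}) ∧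
    ∀ (x : Adj E) (T : Ω → WithTop ℝ≥0) (hT : IsStoppingTime 𝓕 T) (A : Set Ω),
      MeasurableSet[hT.measurableSpace] A →
      P x (A ∩ {ω | T ω ≠ ⊤} ∩ {ω | ∀ i ∈ I, Z ((T ω).untopD 0 + i) ω ∈ B i})
        = ∫⁻ ω in A ∩ {ω | T ω ≠ ⊤},
          P (Z ((T ω).untopD 0) ω) {ω' | ∀ i ∈ I, Z i ω' ∈ B i} ∂(P x) := by
  have := h.isProbabilityMeasure
  have h0 : ∀ I : Finset ℝ≥0, ¬ I.Nonempty → ∀ B : ℝ≥0 → Set (Adj E),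
      (Measurable fun x => P x {ω | ∀ i ∈ I, Z i ω ∈ B i}) ∧
      ∀ (x : Adj E) (T : Ω → WithTop ℝ≥0) (hT : IsStoppingTime 𝓕 T) (A : Set Ω),
        MeasurableSet[hT.measurableSpace] A →
        P x (A ∩ {ω | T ω ≠ ⊤} ∩ {ω | ∀ i ∈ I, Z ((T ω).untopD 0 + i) ω ∈ B i})
          = ∫⁻ ω in A ∩ {ω | T ω ≠ ⊤},
            P (Z ((T ω).untopD 0) ω) {ω' | ∀ i ∈ I, Z i ω' ∈ B i} ∂(P x) := by
    intro I hI B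
    rw [Finset.not_nonempty_iff_eq_empty] at hI
    subst hI
    simp
  induction n with
  | zero =>
    intro I hI B _
    exact h0 I (by rw [Finset.not_nonempty_iff_eq_empty]; simpa using hI) B
  | succ n ih =>
    intro I hI B hB
    by_cases hne : I.Nonempty
    swap
    · exact h0 I hne B
    set t := I.min' hne with ht
    set J := (I.erase (I.min' hne)).image (· - I.min' hne) with hJ
    have hJcard : J.card ≤ n := Nat.lt_succ_iff.1 ((card_image_erase_min'_lt hne).trans_le hI)
    obtain ⟨ih1, ih2⟩ := ih J hJcard (fun j => B (t + j)) fun j => hB _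
    have hG : Measurable ((B t).indicator fun y => P y {ω' | ∀ j ∈ J, Z j ω' ∈ B (t + j)}) :=
      ih1.indicator (hB t)
    have key : ∀ x, P x {ω | ∀ i ∈ I, Z i ω ∈ B i}
        = ∫⁻ ω, (B t).indicator (fun y => P y {ω' | ∀ j ∈ J, Z j ω' ∈ B (t + j)}) (Z t ω) ∂(P x) :=
      fun x => by
        rw [← h.cylinder_eq_of_strongMarkov hB ih2 x]
        congr 1
        ext ω
        exact forall_mem_iff_min' hne (fun i => Z i ω) B
    refine ⟨?_, fun x T hT A hA => ?_⟩
    · simp only [key]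
      exact h.measurable_lintegral t hG
    -- The induction hypothesis is applied at the stopping time `T + t`, with the constraint at the
    -- earliest time `t` absorbed into the event; the one-time strong Markov property at `T` then
    -- finishes the step.
    · have hT' := isStoppingTime_add_const hT t
      have hA' : MeasurableSet[hT'.measurableSpace]
          (A ∩ {ω | Z ((T ω + (t : WithTop ℝ≥0)).untopD 0) ω ∈ B t}) :=
        (IsStoppingTime.measurableSpace_mono hT hT' (fun ω => le_self_add) A hA).inter
          (measurable_eval_stoppingTime h.adapted h.rightContinuous hT' (hB t))
      have h1 := ih2 x _ hT' _ hA'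
      have h2 : A ∩ {ω | T ω ≠ ⊤} ∩ {ω | ∀ i ∈ I, Z ((T ω).untopD 0 + i) ω ∈ B i}
          = A ∩ {ω | Z ((T ω + (t : WithTop ℝ≥0)).untopD 0) ω ∈ B t}
            ∩ {ω | T ω + (t : WithTop ℝ≥0) ≠ ⊤}
            ∩ {ω | ∀ j ∈ J, Z ((T ω + (t : WithTop ℝ≥0)).untopD 0 + j) ω ∈ B (t + j)} := by
        ext ω
        simp only [mem_inter_iff, mem_ofPred_eq]
        by_cases hω : T ω = ⊤
        · simp only [hω, top_add_coe, ne_eq, not_true_eq_false, and_false, false_and]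
        · rw [untopD_add_const hω, forall_mem_iff_min' hne (fun i => Z ((T ω).untopD 0 + i) ω) B]
          simp only [ne_eq, hω, not_false_eq_true, WithTop.add_eq_top, WithTop.coe_ne_top, or_self,
            and_true, ← add_assoc, and_assoc, ht, hJ]
      have h3 : A ∩ {ω | Z ((T ω + (t : WithTop ℝ≥0)).untopD 0) ω ∈ B t}
            ∩ {ω | T ω + (t : WithTop ℝ≥0) ≠ ⊤}
          = {ω | Z ((T ω).untopD 0 + t) ω ∈ B t} ∩ (A ∩ {ω | T ω ≠ ⊤}) := by
        ext ω
        simp only [mem_inter_iff, mem_ofPred_eq]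
        by_cases hω : T ω = ⊤
        · simp only [hω, top_add_coe, ne_eq, not_true_eq_false, and_false]
        · rw [untopD_add_const hω]
          simp only [ne_eq, hω, not_false_eq_true, WithTop.add_eq_top, WithTop.coe_ne_top, or_self,
            and_true]
          exact and_comm
      have hAT : MeasurableSet (A ∩ {ω | T ω ≠ ⊤}) :=
        (hT.measurableSpace_le A hA).inter hT.measurableSet_eq_top.compl
      have hm : MeasurableSet {ω | Z ((T ω).untopD 0 + t) ω ∈ B t} :=
        h.measurable_eval_add hT t (hB t)
      rw [h2, h1, h3]
      simp only [key]
      rw [← h.strongMarkov_lintegral x hT t hA hG, ← Measure.restrict_restrict hm,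
        ← lintegral_indicator hm]
      refine setLIntegral_congr_fun hAT fun ω hω => ?_
      simp only [indicator, mem_ofPred_eq, untopD_add_const hω.2]

theorem IsStandardProcess.measurable_path_law (h : IsStandardProcess 𝓕 P Z) :
    Measurable fun x => (P x).map fun ω t => Z t ω := by
  have := h.isProbabilityMeasure
  have : ∀ x, IsProbabilityMeasure ((P x).map fun ω t => Z t ω) := fun x =>
    Measure.isProbabilityMeasure_map (measurable_path h.measurable).aemeasurable
  refine Measurable.measure_of_isPiSystem_of_isProbabilityMeasure
    generateFrom_squareCylinders.symm
    (isPiSystem_squareCylinders (fun _ => MeasurableSpace.isPiSystem_measurableSet)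
      fun _ => mem_ofPred.2 MeasurableSet.univ) ?_
  rintro _ ⟨I, B, hB, rfl⟩
  have hB' : ∀ i, MeasurableSet (B i) := fun i => hB i (mem_univ i)
  have h1 := (h.cylinder I.card I le_rfl B hB').1
  convert h1 using 2 with x
  rw [Measure.map_apply (measurable_path h.measurable)
    (MeasurableSet.pi I.countable_toSet fun i _ => hB' i)]
  rfl

/-- The strong Markov property for events which depend on the whole path after the time `T`. -/
theorem IsStandardProcess.strongMarkov_path (h : IsStandardProcess 𝓕 P Z) (x : Adj E)
    {T : Ω → WithTop ℝ≥0} (hT : IsStoppingTime 𝓕 T) {A : Set Ω}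
    (hA : MeasurableSet[hT.measurableSpace] A) {Γ : Set (ℝ≥0 → Adj E)} (hΓ : MeasurableSet Γ) :
    P x (A ∩ {ω | T ω ≠ ⊤} ∩ {ω | (fun t => Z ((T ω).untopD 0 + t) ω) ∈ Γ})
      = ∫⁻ ω in A ∩ {ω | T ω ≠ ⊤},
        P (Z ((T ω).untopD 0) ω) {ω' | (fun t => Z t ω') ∈ Γ} ∂(P x) := by
  have := h.isProbabilityMeasure
  have hm1 : Measurable fun ω t => Z ((T ω).untopD 0 + t) ω :=
    measurable_pi_lambda _ fun t => h.measurable_eval_add hT t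
  have hm2 : Measurable fun ω => (P (Z ((T ω).untopD 0) ω)).map fun ω' t => Z t ω' :=
    h.measurable_path_law.comp (h.measurable_eval hT)
  have hm3 := measurable_path h.measurable
  have e1 : ∀ Γ, MeasurableSet Γ →
      ((P x).restrict (A ∩ {ω | T ω ≠ ⊤})).map (fun ω t => Z ((T ω).untopD 0 + t) ω) Γ
        = P x (A ∩ {ω | T ω ≠ ⊤} ∩ {ω | (fun t => Z ((T ω).untopD 0 + t) ω) ∈ Γ}) := fun Γ hΓ => by
    rw [Measure.map_apply hm1 hΓ, Measure.restrict_apply (hm1 hΓ), inter_comm]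
    rfl
  have e2 : ∀ Γ, MeasurableSet Γ →
      ((P x).restrict (A ∩ {ω | T ω ≠ ⊤})).bind
          (fun ω => (P (Z ((T ω).untopD 0) ω)).map fun ω' t => Z t ω') Γ
        = ∫⁻ ω in A ∩ {ω | T ω ≠ ⊤},
          P (Z ((T ω).untopD 0) ω) {ω' | (fun t => Z t ω') ∈ Γ} ∂(P x) := fun Γ hΓ => by
    rw [Measure.bind_apply hΓ hm2.aemeasurable]
    simp only [Measure.map_apply hm3 hΓ]
    rfl
  rw [← e1 Γ hΓ, ← e2 Γ hΓ]
  congr 1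
  refine ext_of_generate_finite _ generateFrom_squareCylinders.symm
    (isPiSystem_squareCylinders (fun _ => MeasurableSpace.isPiSystem_measurableSet)
      fun _ => mem_ofPred.2 MeasurableSet.univ) ?_ ?_
  · rintro _ ⟨I, B, hB, rfl⟩
    have hB' : ∀ i, MeasurableSet (B i) := fun i => hB i (mem_univ i)
    have hΓ' := MeasurableSet.pi I.countable_toSet fun i _ => hB' i
    rw [e1 _ hΓ', e2 _ hΓ']
    exact (h.cylinder I.card I le_rfl B hB').2 x T hT A hA
  · rw [e1 _ .univ, e2 _ .univ]
    simp

/-- The law of a standard process is determined by its transition functions. -/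
theorem IsStandardProcess.law_eq {Ω' : Type*} {m' : MeasurableSpace Ω'}
    {𝓕' : Filtration ℝ≥0 m'} {P' : Adj E → Measure Ω'} {Z' : ℝ≥0 → Ω' → Adj E}
    (h : IsStandardProcess 𝓕 P Z) (h' : IsStandardProcess 𝓕' P' Z')
    (hPP : ∀ x t, (P x).map (Z t) = (P' x).map (Z' t)) (x : Adj E) :
    (P x).map (fun ω t => Z t ω) = (P' x).map fun ω t => Z' t ω := by
  have := h.isProbabilityMeasure
  have := h'.isProbabilityMeasure
  have hm := measurable_path h.measurable
  have hm' := measurable_path h'.measurable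
  have key : ∀ n : ℕ, ∀ I : Finset ℝ≥0, I.card ≤ n → ∀ B : ℝ≥0 → Set (Adj E),
      (∀ i, MeasurableSet (B i)) → ∀ x,
      P x {ω | ∀ i ∈ I, Z i ω ∈ B i} = P' x {ω | ∀ i ∈ I, Z' i ω ∈ B i} := by
    have h0 : ∀ I : Finset ℝ≥0, ¬ I.Nonempty → ∀ (B : ℝ≥0 → Set (Adj E)) (x : Adj E),
        P x {ω | ∀ i ∈ I, Z i ω ∈ B i} = P' x {ω | ∀ i ∈ I, Z' i ω ∈ B i} := by
      intro I hI B x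
      rw [Finset.not_nonempty_iff_eq_empty] at hI
      subst hI
      simp
    intro n
    induction n with
    | zero =>
      intro I hI B _ x
      exact h0 I (by rw [Finset.not_nonempty_iff_eq_empty]; simpa using hI) B x
    | succ n ih =>
      intro I hI B hB x
      by_cases hne : I.Nonempty
      swap
      · exact h0 I hne B x
      set t := I.min' hne with ht
      set J := (I.erase (I.min' hne)).image (· - I.min' hne) with hJ
      have hJcard : J.card ≤ n := Nat.lt_succ_iff.1 ((card_image_erase_min'_lt hne).trans_le hI)
      have ih1 := ih J hJcard (fun j => B (t + j)) fun j => hB _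
      have e1 : {ω | ∀ i ∈ I, Z i ω ∈ B i}
          = {ω | Z t ω ∈ B t ∧ ∀ j ∈ J, Z (t + j) ω ∈ B (t + j)} := by
        ext ω
        exact forall_mem_iff_min' hne (fun i => Z i ω) B
      have e2 : {ω | ∀ i ∈ I, Z' i ω ∈ B i}
          = {ω | Z' t ω ∈ B t ∧ ∀ j ∈ J, Z' (t + j) ω ∈ B (t + j)} := by
        ext ω
        exact forall_mem_iff_min' hne (fun i => Z' i ω) B
      obtain ⟨c1, c2⟩ := h.cylinder J.card J le_rfl (fun j => B (t + j)) fun j => hB _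
      obtain ⟨-, c2'⟩ := h'.cylinder J.card J le_rfl (fun j => B (t + j)) fun j => hB _
      rw [e1, e2, h.cylinder_eq_of_strongMarkov hB c2, h'.cylinder_eq_of_strongMarkov hB c2']
      simp only [← ih1]
      have hG := c1.indicator (hB t)
      rw [← lintegral_map hG (h.measurable t), ← lintegral_map hG (h'.measurable t), hPP]
  have : IsProbabilityMeasure ((P x).map fun ω t => Z t ω) :=
    Measure.isProbabilityMeasure_map hm.aemeasurable
  refine ext_of_generate_finite _ generateFrom_squareCylinders.symm
    (isPiSystem_squareCylinders (fun _ => MeasurableSpace.isPiSystem_measurableSet)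
      fun _ => mem_ofPred.2 MeasurableSet.univ) ?_ ?_
  · rintro _ ⟨I, B, hB, rfl⟩
    have hB' : ∀ i, MeasurableSet (B i) := fun i => hB i (mem_univ i)
    have hΓ' := MeasurableSet.pi I.countable_toSet fun i _ => hB' i
    rw [Measure.map_apply hm hΓ', Measure.map_apply hm' hΓ']
    exact key I.card I le_rfl B hB' x
  · rw [Measure.map_apply hm .univ, Measure.map_apply hm' .univ]
    simp

end StandardProcess

/-! ### The time change of a standard process is a standard process -/

theorem pathIntegral_le_of_originalTime_eq_top {Ω E : Type*} {Z : ℝ≥0 → Ω → Adj E}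
    {f : E → ℝ≥0∞} {ω : Ω}
    {T : Ω → WithTop ℝ≥0} (hT : T ω ≠ ⊤) (h1 : originalTime f Z T ω = ⊤) :
    pathIntegral f Z (lifetime Z ω) ω ≤ ((T ω).untopD 0 : ℝ≥0) := by
  rw [originalTime, if_neg hT, inverseClock] at h1
  split_ifs at h1 with h2
  · exact absurd h1 WithTop.coe_ne_top
  · exact not_lt.1 h2

theorem IsRegularPath.timeChanged_of_dead {Ω E : Type*} [TopologicalSpace E]
    {Z : ℝ≥0 → Ω → Adj E} {f : E → ℝ≥0∞} {ω : Ω} (h : IsRegularPath fun t => Z t ω)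
    (h0 : Z 0 ω = cemetery) (t : ℝ≥0) : timeChanged f Z t ω = cemetery :=
  timeChanged_eq_cemetery (by rw [h.pathIntegral_eq_zero h0]; exact zero_le)

section PathwiseZero

variable {Ω E : Type*} [TopologicalSpace E] [TopologicalSpace.PseudoMetrizableSpace E]
  [MeasurableSpace E] [BorelSpace E] {Z : ℝ≥0 → Ω → Adj E} {ω : Ω} {f : E → ℝ≥0∞}

theorem IsRegularPath.timeChanged_zero (h : IsRegularPath fun t => Z t ω) (hf : IsClockWeight f) :
    timeChanged f Z 0 ω = Z 0 ω := by
  by_cases h0 : Z 0 ω = cemetery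
  · rw [h0, h.timeChanged_of_dead h0]
  · exact h.timeChanged_eq hf h0 (by simp [pathIntegral_zero])

theorem IsRegularPath.pathIntegral_mul_eq_zero_iff (h : IsRegularPath fun t => Z t ω)
    (hf : IsClockWeight f) {g : E → ℝ≥0∞} (hg : Measurable g) (s : ℝ≥0∞) :
    pathIntegral (fun x => f x * g x) Z s ω = 0 ↔ pathIntegral g Z s ω = 0 := by
  have hm : Measurable fun x => f x * g x := hf.measurable.mul hg
  rw [pathIntegral, pathIntegral, lintegral_eq_zero_iff (h.measurable_rate hg),
    lintegral_eq_zero_iff (h.measurable_rate hm)]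
  have key : ∀ x : Adj E, extendZero (fun x => f x * g x) x = 0 ↔ extendZero g x = 0 := by
    rintro (x | x)
    · simp [extendZero, hf.ne_zero x]
    · simp [extendZero]
  refine ⟨fun h1 => h1.mono fun u hu => (key _).1 hu, fun h1 => h1.mono fun u hu => (key _).2 hu⟩

/-- By substitution the new integral has integrand `f * g`, and a positive `f` does not affect
vanishing. The comparison is made before the lifetime, where the clock is finite, and extended by
continuity from below. -/
theorem IsRegularPath.pathIntegral_timeChanged_eq_zero_iff (h : IsRegularPath fun t => Z t ω)
    (hf : IsClockWeight f) {g : E → ℝ≥0∞} (hg : Measurable g) :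
    pathIntegral g (timeChanged f Z) (lifetime (timeChanged f Z) ω) ω = 0
      ↔ pathIntegral g Z (lifetime Z ω) ω = 0 := by
  rw [← not_iff_not, ← ne_eq, ← ne_eq, ← pos_iff_ne_zero, ← pos_iff_ne_zero, lt_pathIntegral_iff,
    lt_pathIntegral_iff, h.lifetime_timeChanged hf]
  have key : ∀ r : ℝ≥0, Z r ω ≠ cemetery →
      (0 < pathIntegral g (timeChanged f Z) (pathIntegral f Z r ω) ω
        ↔ 0 < pathIntegral g Z r ω) := fun r hr => by
    rw [h.pathIntegral_timeChanged hf hg hr, pos_iff_ne_zero, pos_iff_ne_zero, ne_eq, ne_eq,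
      h.pathIntegral_mul_eq_zero_iff hf hg]
  constructor
  · rintro ⟨c, hc, h1⟩
    obtain ⟨r, hr, hrc⟩ := h.exists_pathIntegral_eq hf hc
    exact ⟨r, h.lt_lifetime_iff.2 hr, (key r hr).1 (by rwa [hrc])⟩
  · rintro ⟨r, hr, h1⟩
    rw [h.lt_lifetime_iff] at hr
    have h2 := (key r hr).2 h1
    rw [← ENNReal.coe_toNNReal (h.pathIntegral_ne_top hf hr)] at h2
    refine ⟨_, ?_, h2⟩
    rw [ENNReal.coe_toNNReal (h.pathIntegral_ne_top hf hr)]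
    exact h.pathIntegral_lt_lifetime hf hr

/-- The space of regular paths. -/
abbrev PathSpace (E : Type*) [TopologicalSpace E] : Type _ :=
  {w : ℝ≥0 → Adj E // IsRegularPath w}

/-- The time change is measurable on the space of regular paths, which is not shown to be measurable
in the product. Events of that subspace are traces of product events, and the latter are what the
strong Markov property accepts. -/
theorem exists_timeChanged_event (hf : IsClockWeight f) (t : ℝ≥0) {B : Set (Adj E)}
    (hB : MeasurableSet B) : ∃ Γ : Set (ℝ≥0 → Adj E), MeasurableSet Γ ∧
      ∀ w, IsRegularPath w → (w ∈ Γ ↔ timeChanged f (fun t (_ : Unit) => w t) t () ∈ B) := by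
  have h1 : Measurable (timeChanged f (fun t (w : PathSpace E) => w.1 t) t) :=
    measurable_timeChanged (fun t => (measurable_pi_apply t).comp measurable_subtype_coe)
      (fun w => w.2) hf t
  obtain ⟨Γ, hΓ, h2⟩ := h1 hB
  refine ⟨Γ, hΓ, fun w hw => ?_⟩
  have h3 : (⟨w, hw⟩ : PathSpace E) ∈ Subtype.val ⁻¹' Γ
      ↔ (⟨w, hw⟩ : PathSpace E) ∈ timeChanged f (fun t (w : PathSpace E) => w.1 t) t ⁻¹' B := by
    rw [h2]
  exact h3

end PathwiseZero

section TimeChangedProcess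

variable {Ω E : Type*} {m : MeasurableSpace Ω} [TopologicalSpace E] [T2Space E]
  [LocallyCompactSpace E] [SecondCountableTopology E] [MeasurableSpace E] [BorelSpace E]
  {𝓕 : Filtration ℝ≥0 m} {P : Adj E → Measure Ω} {Z : ℝ≥0 → Ω → Adj E} {f : E → ℝ≥0∞}

theorem originalTime_spec {ω : Ω} (h : IsRegularPath fun t => Z t ω) (hf : IsClockWeight f)
    {T : Ω → WithTop ℝ≥0} (hT : originalTime f Z T ω ≠ ⊤) :
    ∃ t r : ℝ≥0, T ω = t ∧ originalTime f Z T ω = r ∧ Z r ω ≠ cemetery ∧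
      pathIntegral f Z r ω = t := by
  rw [originalTime] at hT ⊢
  split_ifs at hT ⊢ with h1
  · exact absurd rfl hT
  · obtain ⟨t, ht⟩ := WithTop.ne_top_iff_exists.1 h1
    rw [← ht, WithTop.untopD_coe] at hT ⊢
    rcases h.exists_or_dead hf t with ⟨r, hr, h2⟩ | h2
    · exact ⟨t, r, rfl, h.inverseClock_eq hf hr h2, hr, h2⟩
    · exact absurd (inverseClock_eq_top h2) hT

theorem IsStandardProcess.strongMarkov_timeChanged (h : IsStandardProcess 𝓕 P Z)
    [𝓕.IsRightContinuous] (hf : IsClockWeight f) (x : Adj E) (T : Ω → WithTop ℝ≥0)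
    (hT : IsStoppingTime (timeChangedFiltration h.adapted h.regular hf) T) (s : ℝ≥0)
    (A : Set Ω) (hA : MeasurableSet[hT.measurableSpace] A) (B : Set (Adj E))
    (hB : MeasurableSet B) :
    P x (A ∩ {ω | T ω ≠ ⊤} ∩ {ω | timeChanged f Z ((T ω).untopD 0 + s) ω ∈ B})
      = ∫⁻ ω in A ∩ {ω | T ω ≠ ⊤},
        P (timeChanged f Z ((T ω).untopD 0) ω) {ω' | timeChanged f Z s ω' ∈ B} ∂(P x) := by
  have := h.isProbabilityMeasure
  obtain ⟨Γ, hΓ, hΓB⟩ := exists_timeChanged_event hf s hB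
  have hσ := isStoppingTime_originalTime h.adapted h.regular hf hT
  have hAσ := measurableSpace_le_originalTime h.adapted h.regular hf hT A hA
  have hm : MeasurableSet {ω | originalTime f Z T ω = ⊤} := hσ.measurableSet_eq_top
  have hAT : MeasurableSet (A ∩ {ω | T ω ≠ ⊤}) :=
    (hT.measurableSpace_le A hA).inter hT.measurableSet_eq_top.compl
  have hfin : ∀ ω, originalTime f Z T ω ≠ ⊤ → T ω ≠ ⊤ := fun ω h1 h2 =>
    h1 (by rw [originalTime, if_pos h2])
  -- The event `T < ∞` is split according to whether `τ_T` is infinite, when the time-changed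
  -- process is already dead at `T`, or finite.
  rw [← measure_inter_add_sdiff _ hm, ← lintegral_inter_add_sdiff _ _ hm]
  congr 1
  · have h1 : ∀ ω ∈ A ∩ {ω | T ω ≠ ⊤} ∩ {ω | originalTime f Z T ω = ⊤},
        ∀ u, timeChanged f Z ((T ω).untopD 0 + u) ω = cemetery := fun ω hω u =>
      timeChanged_eq_cemetery ((pathIntegral_le_of_originalTime_eq_top hω.1.2 hω.2).trans
        (ENNReal.coe_le_coe.2 le_self_add))
    have h2 : ∀ᵐ ω ∂(P cemetery), timeChanged f Z s ω = cemetery := by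
      filter_upwards [h.start cemetery] with ω hω
      exact (h.regular ω).timeChanged_of_dead hω s
    have h3 : ∫⁻ ω in A ∩ {ω | T ω ≠ ⊤} ∩ {ω | originalTime f Z T ω = ⊤},
        P (timeChanged f Z ((T ω).untopD 0) ω) {ω' | timeChanged f Z s ω' ∈ B} ∂(P x)
        = ∫⁻ ω in A ∩ {ω | T ω ≠ ⊤} ∩ {ω | originalTime f Z T ω = ⊤},
          P cemetery {ω' | timeChanged f Z s ω' ∈ B} ∂(P x) := by
      refine setLIntegral_congr_fun (hAT.inter hm) fun ω hω => ?_
      have h4 := h1 ω hω 0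
      rw [add_zero] at h4
      simp only [h4]
    rw [h3, setLIntegral_const]
    -- On this part both the future of the process and the law `P cemetery` are concentrated at the
    -- extra state, so each side depends only on whether `B` contains it.
    by_cases hc : cemetery ∈ B
    · have h4 : P cemetery {ω' | timeChanged f Z s ω' ∈ B} = 1 := by
        refine (mem_ae_iff_prob_eq_one
          (measurable_timeChanged h.measurable h.regular hf s hB)).1 ?_
        filter_upwards [h2] with ω hω
        rw [mem_preimage, hω]
        exact hc
      rw [h4, one_mul]
      congr 1
      ext ω
      refine ⟨fun hω => ⟨hω.1.1, hω.2⟩, fun hω => ⟨⟨hω.1, ?_⟩, hω.2⟩⟩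
      rw [mem_ofPred_eq, h1 ω hω]
      exact hc
    · have h4 : P cemetery {ω' | timeChanged f Z s ω' ∈ B} = 0 := by
        refine measure_mono_null ?_ h2
        intro ω hω h5
        exact hc (h5 ▸ hω)
      rw [h4, zero_mul, (_ : A ∩ {ω | T ω ≠ ⊤} ∩ {ω | timeChanged f Z ((T ω).untopD 0 + s) ω ∈ B}
        ∩ {ω | originalTime f Z T ω = ⊤} = ∅), measure_empty]
      refine eq_empty_of_forall_notMem fun ω hω => hc ?_
      have h5 := hω.1.2
      rwa [mem_ofPred_eq, h1 ω ⟨hω.1.1, hω.2⟩] at h5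
  · have h1 := h.strongMarkov_path x hσ hAσ hΓ
    have e1 : (A ∩ {ω | T ω ≠ ⊤}) \ {ω | originalTime f Z T ω = ⊤}
        = A ∩ {ω | originalTime f Z T ω ≠ ⊤} := by
      ext ω
      exact ⟨fun hω => ⟨hω.1.1, hω.2⟩, fun hω => ⟨⟨hω.1, hfin ω hω.2⟩, hω.2⟩⟩
    -- The future after `T` is a function of the old path after `τ_T` alone.
    have hval : ∀ ω, originalTime f Z T ω ≠ ⊤ → ∀ u, timeChanged f Z ((T ω).untopD 0 + u) ω
        = timeChanged f (fun t (_ : Unit) => Z ((originalTime f Z T ω).untopD 0 + t) ω) u () := by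
      intro ω hω u
      obtain ⟨t, r, ht, hr, hz, hc⟩ := originalTime_spec (h.regular ω) hf hω
      rw [hr, ht, WithTop.untopD_coe, WithTop.untopD_coe, (h.regular ω).timeChanged_add hf hc]
      rfl
    have e2 : (A ∩ {ω | T ω ≠ ⊤} ∩ {ω | timeChanged f Z ((T ω).untopD 0 + s) ω ∈ B})
          \ {ω | originalTime f Z T ω = ⊤}
        = A ∩ {ω | originalTime f Z T ω ≠ ⊤}
          ∩ {ω | (fun t => Z ((originalTime f Z T ω).untopD 0 + t) ω) ∈ Γ} := by
      ext ω
      simp only [Set.mem_sdiff, mem_inter_iff, mem_ofPred_eq, hΓB _ ((h.regular ω).shift _)]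
      constructor
      · rintro ⟨⟨⟨a1, a2⟩, a3⟩, a4⟩
        exact ⟨⟨a1, a4⟩, by rwa [← hval ω a4]⟩
      · rintro ⟨⟨a1, a2⟩, a3⟩
        exact ⟨⟨⟨a1, hfin ω a2⟩, by rwa [hval ω a2]⟩, a2⟩
    rw [e1, e2, h1]
    refine setLIntegral_congr_fun (e1 ▸ hAT.diff hm) fun ω hω => ?_
    obtain ⟨t, r, ht, hr, hz, hc⟩ := originalTime_spec (h.regular ω) hf hω.2
    simp only [hr, ht, WithTop.untopD_coe, (h.regular ω).timeChanged_eq hf hz hc]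
    congr 1
    ext ω'
    exact hΓB _ (h.regular ω')

/-- For `b < r` the clock at `b` is strictly below `t`, hence below some `T n`, so that `τ_{T n}`
exceeds `b`. This carries quasi-left continuity from the old time scale to the new one. -/
theorem IsRegularPath.iSup_originalTime {ω : Ω} (h : IsRegularPath fun t => Z t ω)
    (hf : IsClockWeight f) {T : ℕ → Ω → WithTop ℝ≥0} {t r : ℝ≥0} (hr : Z r ω ≠ cemetery)
    (hrt : pathIntegral f Z r ω = t) (hT : ⨆ n, T n ω = (t : WithTop ℝ≥0)) :
    ⨆ n, originalTime f Z (T n) ω = (r : WithTop ℝ≥0) ∧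
      ∀ n, timeChanged f Z ((T n ω).untopD 0) ω = Z ((originalTime f Z (T n) ω).untopD 0) ω := by
  have h1 : ∀ n, ∃ s q : ℝ≥0, T n ω = s ∧ originalTime f Z (T n) ω = q ∧ q ≤ r ∧
      Z q ω ≠ cemetery ∧ pathIntegral f Z q ω = s := by
    intro n
    have h2 : T n ω ≤ t := hT ▸ le_iSup (fun n => T n ω) n
    obtain ⟨s, hs⟩ := WithTop.ne_top_iff_exists.1 (h2.trans_lt (WithTop.coe_lt_top t)).ne
    rw [← hs, WithTop.coe_le_coe] at h2
    obtain ⟨q, hq, hqs⟩ := h.exists_pathIntegral_eq hf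
      ((ENNReal.coe_le_coe.2 h2).trans_lt (hrt ▸ h.pathIntegral_lt_lifetime hf hr))
    refine ⟨s, q, hs.symm, ?_, ?_, hq, hqs⟩
    · rw [originalTime, if_neg (by rw [← hs]; exact WithTop.coe_ne_top), ← hs]
      exact h.inverseClock_eq hf hq hqs
    · refine le_of_not_gt fun h3 => ?_
      have h4 := h.pathIntegral_lt hf hr (ENNReal.coe_lt_coe.2 h3)
      rw [hqs, hrt, ENNReal.coe_lt_coe] at h4
      exact absurd h2 (not_le.2 h4)
  choose s q hs hq hqr hz hqs using h1
  refine ⟨?_, fun n => ?_⟩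
  · refine iSup_eq_of_forall_le_of_forall_lt_exists_gt (fun n => ?_) fun b hb => ?_
    · rw [hq]
      exact WithTop.coe_le_coe.2 (hqr n)
    · obtain ⟨b, rfl⟩ := WithTop.ne_top_iff_exists.1 hb.ne_top
      have hbr := WithTop.coe_lt_coe.1 hb
      have hzb := h.alive_mono hbr.le hr
      have h2 := h.pathIntegral_lt hf hzb (ENNReal.coe_lt_coe.2 hbr)
      rw [hrt] at h2
      obtain ⟨c, hc⟩ : ∃ c : ℝ≥0, (c : ℝ≥0∞) = pathIntegral f Z b ω :=
        ⟨_, ENNReal.coe_toNNReal h2.ne_top⟩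
      rw [← hc, ENNReal.coe_lt_coe, ← WithTop.coe_lt_coe, ← hT, lt_iSup_iff] at h2
      obtain ⟨n, hn⟩ := h2
      refine ⟨n, ?_⟩
      rw [hq]
      rw [hs, WithTop.coe_lt_coe, ← ENNReal.coe_lt_coe, hc, ← hqs, h.pathIntegral_lt_iff hf hzb,
        ENNReal.coe_lt_coe] at hn
      exact WithTop.coe_lt_coe.2 hn
  · rw [hs, hq]
    exact h.timeChanged_eq hf (hz n) (hqs n)

theorem IsStandardProcess.timeChange (h : IsStandardProcess 𝓕 P Z) [𝓕.IsRightContinuous]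
    (hf : IsClockWeight f) :
    IsStandardProcess (timeChangedFiltration h.adapted h.regular hf) P (timeChanged f Z) where
  isProbabilityMeasure := h.isProbabilityMeasure
  rightContinuous_filtration := isRightContinuous_timeChangedFiltration h.adapted h.regular hf
  complete N hN hP A hAN :=
    (isStoppingTime_inverseClock h.adapted h.regular hf 0).le_measurableSpace_of_const_le
      (i := 0) (fun _ => bot_le) A (h.complete N hN hP A hAN)
  adapted t := by
    classical
    have hτ := isStoppingTime_inverseClock h.adapted h.regular hf t
    have h2 : timeChanged f Z t = fun ω => if inverseClock f Z t ω = ⊤ then cemetery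
        else Z ((inverseClock f Z t ω).untopD 0) ω := funext fun ω => timeChanged_eq_ite f Z t ω
    rw [h2]
    exact Measurable.ite (hτ.measurable (measurableSet_singleton ⊤)) measurable_const
      (measurable_eval_stoppingTime h.adapted h.rightContinuous hτ)
  measurable_transition t B hB := by
    obtain ⟨Γ, hΓ, hΓB⟩ := exists_timeChanged_event hf t hB
    have h1 := (Measure.measurable_measure.1 h.measurable_path_law) Γ hΓ
    convert h1 using 2 with x
    rw [Measure.map_apply (measurable_path h.measurable) hΓ]
    congr 1
    ext ω
    exact (hΓB _ (h.regular ω)).symm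
  start x := by
    filter_upwards [h.start x] with ω hω
    rw [(h.regular ω).timeChanged_zero hf, hω]
  absorbed ω t ht := by
    by_contra h1
    exact absurd (((h.regular ω).timeChange hf).lt_lifetime_iff.2 h1) (not_lt.2 ht)
  rightContinuous ω t := ((h.regular ω).timeChange hf).rightContinuous t
  leftLimits ω t ht h1 := ((h.regular ω).timeChange hf).leftLimits t ht
    (((h.regular ω).timeChange hf).lt_lifetime_iff.1 h1)
  strongMarkov := h.strongMarkov_timeChanged hf
  quasiLeftContinuous x T hT hmono := by
    have h1 := h.quasiLeftContinuous x (fun n => originalTime f Z (T n))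
      (fun n => isStoppingTime_originalTime h.adapted h.regular hf (hT n)) fun n ω => by
        have h2 := hmono n ω
        by_cases h3 : T (n + 1) ω = ⊤
        · rw [originalTime, originalTime, if_pos h3]
          exact le_top
        · have h4 : T n ω ≠ ⊤ := fun h5 => h3 (top_le_iff.1 (h5 ▸ h2))
          rw [originalTime, originalTime, if_neg h3, if_neg h4]
          refine inverseClock_mono (h.regular ω) hf ?_
          lift T (n + 1) ω to ℝ≥0 using h3 with a
          lift T n ω to ℝ≥0 using h4 with b
          exact WithTop.coe_le_coe.1 h2
    filter_upwards [h1] with ω hω t ht hlt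
    rw [(h.regular ω).lifetime_timeChanged hf] at hlt
    obtain ⟨r, hr, hrt⟩ := (h.regular ω).exists_pathIntegral_eq hf hlt
    obtain ⟨h2, h3⟩ := (h.regular ω).iSup_originalTime hf hr hrt ht
    simp only [h3, (h.regular ω).timeChanged_eq hf hr hrt]
    exact hω r h2 ((h.regular ω).lt_lifetime_iff.2 hr)
  referenceMeasure := by
    obtain ⟨μ, hμ, h1⟩ := h.referenceMeasure
    -- The same `μ` serves: a potential vanishes exactly when almost every path spends no time in
    -- `B`, and the time change preserves this path by path.
    refine ⟨μ, hμ, fun x B hB => ?_⟩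
    rw [← h1 x B hB, potential, potential]
    have hg : Measurable (B.indicator (1 : E → ℝ≥0∞)) := measurable_one.indicator hB
    have h2 := measurable_pathIntegral h.measurable h.rightContinuous hg ⊤
    have h3 := measurable_pathIntegral
      (measurable_timeChanged h.measurable h.regular hf)
      (fun ω => ((h.regular ω).timeChange hf).rightContinuous) hg ⊤
    have h4 : (fun ω => pathIntegral (B.indicator 1) Z (lifetime Z ω) ω)
        = pathIntegral (B.indicator 1) Z ⊤ := funext fun ω => (h.regular ω).pathIntegral_lifetime
    have h5 : (fun ω => pathIntegral (B.indicator 1) (timeChanged f Z)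
          (lifetime (timeChanged f Z) ω) ω)
        = pathIntegral (B.indicator 1) (timeChanged f Z) ⊤ :=
      funext fun ω => ((h.regular ω).timeChange hf).pathIntegral_lifetime
    rw [lintegral_eq_zero_iff (h5 ▸ h3), lintegral_eq_zero_iff (h4 ▸ h2)]
    have key := fun ω => (h.regular ω).pathIntegral_timeChanged_eq_zero_iff hf hg
    exact ⟨fun h6 => h6.mono fun ω hω => (key ω).1 hω, fun h6 => h6.mono fun ω hω => (key ω).2 hω⟩

end TimeChangedProcess

/-! ### Images of standard processes, and laws of time-changed processes -/

theorem measurable_map_state {E E' : Type*} [MeasurableSpace E] [MeasurableSpace E'] {e : E → E'}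
    (he : Measurable e) : Measurable (Sum.map e id : Adj E → Adj E') :=
  measurable_fun_sum (measurable_inl.comp he) measurable_inr

theorem lifetime_map {Ω E E' : Type*} (e : E → E') (Z : ℝ≥0 → Ω → Adj E) (ω : Ω) :
    lifetime (fun t ω => (Sum.map e id (Z t ω) : Adj E')) ω = lifetime Z ω := by
  simp only [lifetime, map_eq_cemetery_iff]

theorem pathIntegral_indicator_map {Ω E E' : Type*} (e : E → E') (Z : ℝ≥0 → Ω → Adj E) (ω : Ω)
    (B : Set E') (s : ℝ≥0∞) :
    pathIntegral (B.indicator 1) (fun t ω => (Sum.map e id (Z t ω) : Adj E')) s ω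
      = pathIntegral ((e ⁻¹' B).indicator 1) Z s ω := by
  have h1 : ∀ x : Adj E, extendZero (B.indicator 1) (Sum.map e id x)
      = extendZero ((e ⁻¹' B).indicator 1) x := by
    rintro (x | x)
    · rfl
    · rfl
  simp only [pathIntegral, h1]

theorem potential_map {Ω E E' : Type*} [MeasurableSpace Ω] (e : E ≃ E') (P : Adj E → Measure Ω)
    (Z : ℝ≥0 → Ω → Adj E) (x : Adj E') (B : Set E') :
    potential (fun x => P (Sum.map e.symm id x)) (fun t ω => (Sum.map e id (Z t ω) : Adj E')) x B
      = potential P Z (Sum.map e.symm id x) (e ⁻¹' B) := by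
  simp only [potential, lifetime_map, pathIntegral_indicator_map]

theorem map_symm_map {E E' : Type*} (e : E ≃ E') (x : Adj E) :
    (Sum.map e.symm id (Sum.map e id x : Adj E') : Adj E) = x := by
  rcases x with x | x <;> simp [Sum.map]

theorem map_map_symm {E E' : Type*} (e : E ≃ E') (x : Adj E') :
    (Sum.map e id (Sum.map e.symm id x : Adj E) : Adj E') = x := by
  rcases x with x | x <;> simp [Sum.map]

/-- The mass of the extra state is what is missing from total mass one. -/
theorem ext_of_lintegral_extendZero {E : Type*} [MeasurableSpace E] {μ ν : Measure (Adj E)}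
    [IsProbabilityMeasure μ]
    [IsProbabilityMeasure ν]
    (h : ∀ g : E → ℝ≥0∞, Measurable g → ∫⁻ x, extendZero g x ∂μ = ∫⁻ x, extendZero g x ∂ν) :
    μ = ν := by
  have key : ∀ B : Set (Adj E), MeasurableSet B → cemetery ∉ B → μ B = ν B := fun B hB hc => by
    have h1 := h ((Sum.inl ⁻¹' B).indicator 1) (measurable_one.indicator (measurable_inl hB))
    have h2 : extendZero ((Sum.inl ⁻¹' B).indicator 1) = B.indicator 1 := by
      funext x
      rcases x with x | x
      · rfl
      · exact (indicator_of_notMem hc _).symm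
    rwa [h2, lintegral_indicator_one hB, lintegral_indicator_one hB] at h1
  ext B hB
  by_cases hc : cemetery ∈ B
  · have h1 := key Bᶜ hB.compl (fun h => h hc)
    rw [← compl_compl B, prob_compl_eq_one_sub hB.compl, prob_compl_eq_one_sub hB.compl, h1]
  · exact key B hB hc

section Standard

variable {Ω E : Type*} {m : MeasurableSpace Ω} [TopologicalSpace E] [T2Space E]
  [LocallyCompactSpace E] [SecondCountableTopology E] [MeasurableSpace E] [BorelSpace E]
  {𝓕 : Filtration ℝ≥0 m} {P : Adj E → Measure Ω} {Z : ℝ≥0 → Ω → Adj E}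

theorem IsStandardProcess.map {E' : Type*} [TopologicalSpace E'] [T2Space E']
    [LocallyCompactSpace E'] [SecondCountableTopology E'] [MeasurableSpace E'] [BorelSpace E']
    (h : IsStandardProcess 𝓕 P Z) (e : E ≃ₜ E') :
    IsStandardProcess 𝓕 (fun x => P (Sum.map e.symm id x))
      (fun t ω => (Sum.map e id (Z t ω) : Adj E')) where
  isProbabilityMeasure x := h.isProbabilityMeasure _
  rightContinuous_filtration := h.rightContinuous_filtration
  complete N hN hP A hA := h.complete N hN (fun x => by
    have h1 := hP (Sum.map e id x)
    rwa [show Sum.map e.symm id (Sum.map e id x : Adj E') = x from map_symm_map e.toEquiv x] at h1)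
    A hA
  adapted t := (measurable_map_state e.continuous.measurable).comp (h.adapted t)
  measurable_transition t B hB :=
    (h.measurable_transition t _ (measurable_map_state e.continuous.measurable hB)).comp
      (measurable_map_state e.symm.continuous.measurable)
  start x := by
    filter_upwards [h.start (Sum.map e.symm id x)] with ω hω
    rw [hω]
    exact map_map_symm e.toEquiv x
  absorbed ω t ht := by
    rw [lifetime_map] at ht
    exact map_eq_cemetery_iff.2 (h.absorbed ω t ht)
  rightContinuous ω t := (continuous_map e.continuous).continuousAt.comp_continuousWithinAt
    (h.rightContinuous ω t)
  leftLimits ω t ht h1 := by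
    rw [lifetime_map] at h1
    obtain ⟨l, hl⟩ := h.leftLimits ω t ht h1
    exact ⟨Sum.map e id l, ((continuous_map e.continuous).tendsto l).comp hl⟩
  strongMarkov x T hT s A hA B hB := by
    have h1 := h.strongMarkov (Sum.map e.symm id x) T hT s A hA _
      (measurable_map_state e.continuous.measurable hB)
    refine h1.trans (lintegral_congr fun ω => ?_)
    rw [show Sum.map e.symm id (Sum.map e id (Z ((T ω).untopD 0) ω) : Adj E')
      = Z ((T ω).untopD 0) ω from map_symm_map e.toEquiv _]
    rfl
  quasiLeftContinuous x T hT hmono := by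
    filter_upwards [h.quasiLeftContinuous (Sum.map e.symm id x) T hT hmono] with ω hω t ht h1
    rw [lifetime_map] at h1
    exact ((continuous_map e.continuous).tendsto _).comp (hω t ht h1)
  referenceMeasure := by
    obtain ⟨μ, hμ, h1⟩ := h.referenceMeasure
    refine ⟨μ.map e, e.toMeasurableEquiv.sigmaFinite_map, fun x B hB => ?_⟩
    rw [Measure.map_apply e.continuous.measurable hB, ← h1 (e.symm x) _
      (e.continuous.measurable hB)]
    exact (potential_map e.toEquiv P Z (Sum.inl x) B).congr_left

/-- Equality of the laws of two processes with regular paths passes to their time changes. -/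
theorem law_timeChanged_eq {Ω' : Type*} {m' : MeasurableSpace Ω'} {W : ℝ≥0 → Ω → Adj E}
    {W' : ℝ≥0 → Ω' → Adj E} (hW : ∀ t, Measurable (W t)) (hW' : ∀ t, Measurable (W' t))
    (hr : ∀ ω, IsRegularPath fun t => W t ω) (hr' : ∀ ω, IsRegularPath fun t => W' t ω)
    {μ : Measure Ω} {μ' : Measure Ω'}
    (h : μ.map (fun ω t => W t ω) = μ'.map fun ω t => W' t ω) {f : E → ℝ≥0∞}
    (hf : IsClockWeight f) :
    μ.map (fun ω t => timeChanged f W t ω) = μ'.map fun ω t => timeChanged f W' t ω := by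
  let p : Ω → PathSpace E := fun ω => ⟨fun t => W t ω, hr ω⟩
  let p' : Ω' → PathSpace E := fun ω => ⟨fun t => W' t ω, hr' ω⟩
  have hp : Measurable p := (measurable_path hW).subtype_mk
  have hp' : Measurable p' := (measurable_path hW').subtype_mk
  have h1 : μ.map p = μ'.map p' := by
    ext A hA
    obtain ⟨Γ, hΓ, rfl⟩ := hA
    rw [Measure.map_apply hp (measurable_subtype_coe hΓ),
      Measure.map_apply hp' (measurable_subtype_coe hΓ)]
    have h2 := congrArg (fun ν => ν Γ) h
    simp only [Measure.map_apply (measurable_path hW) hΓ,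
      Measure.map_apply (measurable_path hW') hΓ] at h2
    exact h2
  have hΦ : Measurable fun (w : PathSpace E) t =>
      timeChanged f (fun t (w : PathSpace E) => w.1 t) t w := measurable_pi_lambda _ fun t =>
    measurable_timeChanged (fun t => (measurable_pi_apply t).comp measurable_subtype_coe)
      (fun w => w.2) hf t
  have h2 := congrArg (Measure.map fun (w : PathSpace E) t =>
      timeChanged f (fun t (w : PathSpace E) => w.1 t) t w) h1
  rwa [Measure.map_map hΦ hp, Measure.map_map hΦ hp'] at h2

theorem IsStandardProcess.ae_cemetery (h : IsStandardProcess 𝓕 P Z) (t : ℝ≥0) :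
    ∀ᵐ ω ∂(P cemetery), Z t ω = cemetery := by
  filter_upwards [h.start cemetery] with ω hω
  exact (h.regular ω).absorbed 0 t zero_le hω

/-- The Markov property at a fixed time, for functions of the states at two times. -/
theorem IsStandardProcess.markov_lintegral_prod (h : IsStandardProcess 𝓕 P Z) (x : Adj E)
    (t s : ℝ≥0) {A : Set Ω} (hA : MeasurableSet[𝓕 t] A) {G : Adj E × Adj E → ℝ≥0∞}
    (hG : Measurable G) :
    ∫⁻ ω in A, G (Z t ω, Z (t + s) ω) ∂(P x)
      = ∫⁻ ω in A, ∫⁻ ω', G (Z t ω, Z s ω') ∂(P (Z t ω)) ∂(P x) := by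
  have := h.isProbabilityMeasure
  let κ : ProbabilityTheory.Kernel (Adj E) (Adj E) := ⟨fun y => (P y).map (Z s), h.measurable_map s⟩
  have hκ : ProbabilityTheory.IsMarkovKernel κ :=
    ⟨fun y => Measure.isProbabilityMeasure_map (h.measurable s).aemeasurable⟩
  have hp : Measurable fun ω => (Z t ω, Z (t + s) ω) := (h.measurable t).prodMk (h.measurable _)
  -- The joint law of the two states is the law at time `t` composed with the transition kernel; on
  -- rectangles this is the strong Markov property at the constant time `t`.
  have h1 : ((P x).restrict A).map (fun ω => (Z t ω, Z (t + s) ω))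
      = (((P x).restrict A).map (Z t)).compProd κ := by
    refine Measure.ext_prod fun {B C} hB hC => ?_
    have hAB : MeasurableSet[(isStoppingTime_const 𝓕 t).measurableSpace] (A ∩ Z t ⁻¹' B) := by
      rw [IsStoppingTime.measurableSpace_const]
      exact hA.inter (h.adapted t hB)
    have h2 := h.strongMarkov x _ (isStoppingTime_const 𝓕 t) s _ hAB C hC
    have h3 : {ω : Ω | (t : WithTop ℝ≥0) ≠ ⊤} = univ := by
      ext
      simp only [ne_eq, WithTop.coe_ne_top, not_false_eq_true, mem_ofPred_eq, mem_univ]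
    rw [h3, inter_univ] at h2
    rw [Measure.map_apply hp (hB.prod hC), Measure.restrict_apply (hp (hB.prod hC)),
      Measure.compProd_apply_prod hB hC, setLIntegral_map hB (κ.measurable_coe hC) (h.measurable t),
      Measure.restrict_restrict (h.measurable t hB), inter_comm (Z t ⁻¹' B)]
    refine Eq.trans ?_ (h2.trans ?_)
    · congr 1
      ext ω
      exact ⟨fun hω => ⟨⟨hω.2, hω.1.1⟩, hω.1.2⟩, fun hω => ⟨⟨hω.1.2, hω.2⟩, hω.1.1⟩⟩
    · refine lintegral_congr fun ω => ?_
      exact (Measure.map_apply (h.measurable s) hC).symm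
  rw [← lintegral_map hG hp, h1, Measure.lintegral_compProd hG,
    lintegral_map hG.lintegral_kernel_prod_right' (h.measurable t)]
  refine lintegral_congr fun ω => ?_
  exact lintegral_map (hG.comp measurable_prodMk_left) (h.measurable s)

end Standard

/-! ### The Lamperti transformation -/

/-- Translation of the second coordinate. -/
def translate (S : Type*) [TopologicalSpace S] (b : ℝ) : S × ℝ ≃ₜ S × ℝ :=
  (Homeomorph.refl S).prodCongr (Homeomorph.addRight b)

theorem translate_apply {S : Type*} [TopologicalSpace S] (b : ℝ) (p : S × ℝ) :
    translate S b p = (p.1, p.2 + b) := rfl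

theorem translate_symm_apply {S : Type*} [TopologicalSpace S] (b : ℝ) (p : S × ℝ) :
    (translate S b).symm p = (p.1, p.2 - b) := by
  rw [Homeomorph.symm_apply_eq, translate_apply, sub_add_cancel]

theorem isClockWeight_expWeight {S : Type*} [TopologicalSpace S] (α : ℝ) :
    IsClockWeight (expWeight α : S × ℝ → ℝ≥0∞) where
  continuous := by
    unfold expWeight
    exact ENNReal.continuous_ofReal.comp (by fun_prop)
  ne_zero p := (ENNReal.ofReal_pos.2 (Real.exp_pos _)).ne'
  ne_top p := ENNReal.ofReal_ne_top

theorem expWeight_translate {S : Type*} [TopologicalSpace S] (α : ℝ) {a : ℝ≥0} (ha : 0 < a)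
    (p : S × ℝ) :
    expWeight α (translate S (Real.log a) p) = (a ^ α : ℝ≥0) * expWeight α p := by
  have h1 : (a : ℝ) ^ α = Real.exp (α * Real.log a) := by
    rw [Real.rpow_def_of_pos (NNReal.coe_pos.2 ha), mul_comm]
  rw [expWeight, expWeight, translate_apply, mul_add, Real.exp_add, mul_comm,
    ENNReal.ofReal_mul (Real.exp_pos _).le, ← h1, ← NNReal.coe_rpow, ENNReal.ofReal_coe_nnreal]

/-! ### Scaling and weights in polar coordinates -/

section Cone

variable {d : ℕ} {S : Set (UnitSphere d)}

/-- Multiplication by `a > 0` on the cone. -/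
noncomputable def coneSMul {a : ℝ≥0} (ha : 0 < a) (x : cone S) : cone S :=
  ⟨(a : ℝ) • (x : EuclideanSpace ℝ (Fin d)), cone_smul_mem ha x⟩

theorem scale_eq {a : ℝ≥0} (ha : 0 < a) :
    (scale ha : Adj (cone S) → Adj (cone S)) = Sum.map (coneSMul ha) id := rfl

theorem continuous_coneSMul {a : ℝ≥0} (ha : 0 < a) :
    Continuous (coneSMul ha : cone S → cone S) :=
  (continuous_subtype_val.const_smul (a : ℝ)).subtype_mk _

theorem norm_polar (p : S × ℝ) :
    ‖(polar S p : EuclideanSpace ℝ (Fin d))‖ = Real.exp p.2 := norm_exp_smul _ _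

theorem polar_translate {a : ℝ≥0} (ha : 0 < a) (p : S × ℝ) :
    polar S (translate S (Real.log a) p) = coneSMul ha (polar S p) := by
  refine Subtype.ext ?_
  change Real.exp (p.2 + Real.log a) • ((p.1 : UnitSphere d) : EuclideanSpace ℝ (Fin d))
    = (a : ℝ) • Real.exp p.2 • ((p.1 : UnitSphere d) : EuclideanSpace ℝ (Fin d))
  rw [smul_smul, Real.exp_add, Real.exp_log (NNReal.coe_pos.2 ha), mul_comm]

theorem polar_symm_coneSMul {a : ℝ≥0} (ha : 0 < a) (x : cone S) :
    (polar S).symm (coneSMul ha x) = translate S (Real.log a) ((polar S).symm x) := by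
  rw [Homeomorph.symm_apply_eq, polar_translate ha, Homeomorph.apply_symm_apply]

theorem polar_symm_coneSMul_inv {a : ℝ≥0} (ha : 0 < a) (x : cone S) :
    (polar S).symm (coneSMul (inv_pos.2 ha) x)
      = (translate S (Real.log a)).symm ((polar S).symm x) := by
  rw [polar_symm_coneSMul, translate_symm_apply, translate_apply, NNReal.coe_inv, Real.log_inv,
    sub_eq_add_neg]

theorem isClockWeight_normWeight (α : ℝ) :
    IsClockWeight (normWeight α : cone S → ℝ≥0∞) where
  continuous := by
    unfold normWeight
    have h : Continuous fun x : cone S => ‖(x : EuclideanSpace ℝ (Fin d))‖ := by fun_prop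
    exact ENNReal.continuous_ofReal.comp
      (h.rpow_const fun x => Or.inl (cone_norm_pos x).ne')
  ne_zero x := (ENNReal.ofReal_pos.2 (Real.rpow_pos_of_pos (cone_norm_pos x) _)).ne'
  ne_top x := ENNReal.ofReal_ne_top

theorem normWeight_polar (α : ℝ) (p : S × ℝ) :
    normWeight α (polar S p) = (expWeight α p)⁻¹ := by
  rw [normWeight, expWeight, norm_polar, ← ENNReal.ofReal_inv_of_pos (Real.exp_pos _),
    ← Real.exp_mul, ← Real.exp_neg]
  congr 2
  ring

theorem expWeight_polar_symm (α : ℝ) (x : cone S) :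
    expWeight α ((polar S).symm x) = (normWeight α x)⁻¹ := by
  obtain ⟨p, rfl⟩ := (polar S).surjective x
  rw [normWeight_polar, inv_inv, Homeomorph.symm_apply_apply]

theorem normWeight_coneSMul (α : ℝ) {a : ℝ≥0} (ha : 0 < a) (x : cone S) :
    normWeight α (coneSMul ha x) = (a ^ (-α) : ℝ≥0) * normWeight α x := by
  have h1 : ‖(coneSMul ha x : EuclideanSpace ℝ (Fin d))‖
      = a * ‖(x : EuclideanSpace ℝ (Fin d))‖ := by
    change ‖(a : ℝ) • (x : EuclideanSpace ℝ (Fin d))‖ = _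
    rw [norm_smul, Real.norm_eq_abs, NNReal.abs_eq]
  rw [normWeight, normWeight, h1, Real.mul_rpow a.coe_nonneg (norm_nonneg _),
    ENNReal.ofReal_mul (Real.rpow_nonneg a.coe_nonneg _), ← NNReal.coe_rpow,
    ENNReal.ofReal_coe_nnreal]

end Cone

/-! ### The two transformations are mutually inverse -/

section Inversion

variable {Ω : Type*} {d : ℕ} {S : Set (UnitSphere d)}

theorem mapOfSsMp_ssMpOfMAP (α : ℝ) {Z : ℝ≥0 → Ω → Adj (S × ℝ)}
    (h : ∀ ω, IsRegularPath fun t => Z t ω) : mapOfSsMp α (ssMpOfMAP α Z) = Z := by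
  funext t ω
  have hf := isClockWeight_expWeight (S := S) α
  have h1 := ((h ω).timeChange hf).timeChanged_map (W := ssMpOfMAP α Z) (ω' := ω) hf.inv
    (isClockWeight_normWeight α) (polar S).continuous one_pos (c := 1) one_pos
    (fun x => by rw [normWeight_polar, ENNReal.coe_one, one_mul])
    (fun t => by rw [one_mul]; rfl) t
  rw [mapOfSsMp, h1, div_one, one_mul, (h ω).timeChanged_inv_timeChanged hf]
  exact map_symm_map (polar S).toEquiv _

theorem ssMpOfMAP_mapOfSsMp (α : ℝ) {X : ℝ≥0 → Ω → Adj (cone S)}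
    (h : ∀ ω, IsRegularPath fun t => X t ω) : ssMpOfMAP α (mapOfSsMp α X) = X := by
  funext t ω
  have hf := isClockWeight_normWeight (S := S) α
  have h1 := ((h ω).timeChange hf).timeChanged_map (W := mapOfSsMp α X) (ω' := ω) hf.inv
    (isClockWeight_expWeight α) (polar S).symm.continuous one_pos (c := 1) one_pos
    (fun x => by rw [expWeight_polar_symm, ENNReal.coe_one, one_mul])
    (fun t => by rw [one_mul]; rfl) t
  rw [ssMpOfMAP, h1, div_one, one_mul, (h ω).timeChanged_inv_timeChanged hf]
  exact map_map_symm (polar S).toEquiv _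

theorem lifetime_ssMpOfMAP (α : ℝ) {Z : ℝ≥0 → Ω → Adj (S × ℝ)} {ω : Ω}
    (h : IsRegularPath fun t => Z t ω) :
    lifetime (ssMpOfMAP α Z) ω = pathIntegral (expWeight α) Z (lifetime Z ω) ω :=
  (lifetime_map (polar S) (timeChanged (expWeight α) Z) ω).trans
    (h.lifetime_timeChanged (isClockWeight_expWeight α))

theorem lifetime_mapOfSsMp (α : ℝ) {X : ℝ≥0 → Ω → Adj (cone S)} {ω : Ω}
    (h : IsRegularPath fun t => X t ω) :
    lifetime (mapOfSsMp α X) ω = pathIntegral (normWeight α) X (lifetime X ω) ω :=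
  (lifetime_map (polar S).symm (timeChanged (normWeight α) X) ω).trans
    (h.lifetime_timeChanged (isClockWeight_normWeight α))

theorem mapLaw_ssMpLaw [MeasurableSpace Ω] (P : Adj (S × ℝ) → Measure Ω) :
    mapLaw (ssMpLaw P) = P :=
  funext fun x => congrArg P (map_symm_map (polar S).toEquiv x)

theorem ssMpLaw_mapLaw [MeasurableSpace Ω] (P : Adj (cone S) → Measure Ω) :
    ssMpLaw (mapLaw P) = P :=
  funext fun x => congrArg P (map_map_symm (polar S).toEquiv x)

end Inversion

theorem measurable_onIncrement {S : Type*} [MeasurableSpace S] {f : S × ℝ → ℝ≥0∞}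
    (hf : Measurable f) :
    Measurable fun x : Adj (S × ℝ) × Adj (S × ℝ) => onIncrement f x.1 x.2 := by
  refine (MeasurableEquiv.sumProdSum (S × ℝ) Unit (S × ℝ) Unit).symm.measurable_comp_iff.1 ?_
  refine measurable_fun_sum (measurable_fun_sum ?_ ?_) (measurable_fun_sum ?_ ?_)
  · exact hf.comp ((measurable_fst.comp measurable_snd).prodMk
      ((measurable_snd.comp measurable_snd).sub (measurable_snd.comp measurable_fst)))
  all_goals exact measurable_const

/-! ### Additivity as translation invariance -/

section Additive

variable {Ω S : Type*} {m : MeasurableSpace Ω} [TopologicalSpace S] [T2Space S]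
  [LocallyCompactSpace S] [SecondCountableTopology S] [MeasurableSpace S] [BorelSpace S]
  {𝓕 : Filtration ℝ≥0 m} {P : Adj (S × ℝ) → Measure Ω} {Z : ℝ≥0 → Ω → Adj (S × ℝ)}

theorem IsMAP.lintegral_eq (h : IsMAP 𝓕 P Z) (p : S × ℝ) (s : ℝ≥0) {g : S × ℝ → ℝ≥0∞}
    (hg : Measurable g) :
    ∫⁻ ω, extendZero g (Z s ω) ∂(P (Sum.inl p))
      = ∫⁻ ω, extendZero g (Sum.map (translate S p.2) id (Z s ω)) ∂(P (Sum.inl (p.1, 0))) := by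
  have hf : Measurable fun q => g (translate S p.2 q) :=
    hg.comp (translate S p.2).continuous.measurable
  -- At `t = 0` the process sits at `p` almost surely, so the increment is the state at time `s`
  -- minus `p.2`, and composing `g` with the translation by `p.2` undoes this subtraction.
  have h1 := h.additive p 0 s _ hf univ MeasurableSet.univ
  rw [Measure.restrict_univ, zero_add] at h1
  have h2 : ∫⁻ ω, onIncrement (fun q => g (translate S p.2 q)) (Z 0 ω) (Z s ω) ∂(P (Sum.inl p))
      = ∫⁻ ω, extendZero g (Z s ω) ∂(P (Sum.inl p)) := by
    refine lintegral_congr_ae ?_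
    filter_upwards [h.standard.start (Sum.inl p)] with ω hω
    rw [hω]
    rcases Z s ω with q | q
    · simp only [onIncrement, extendZero, Sum.elim_inl, translate_apply, sub_add_cancel]
    · rfl
  have h3 : ∫⁻ ω, restarted P Z (fun q => g (translate S p.2 q)) s (Z 0 ω) ∂(P (Sum.inl p))
      = ∫⁻ ω, extendZero (fun q => g (translate S p.2 q)) (Z s ω) ∂(P (Sum.inl (p.1, 0))) := by
    have := h.standard.isProbabilityMeasure (Sum.inl p)
    rw [lintegral_congr_ae (g := fun _ => restarted P Z (fun q => g (translate S p.2 q)) s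
      (Sum.inl p)), lintegral_const, measure_univ, mul_one]
    · rfl
    · filter_upwards [h.standard.start (Sum.inl p)] with ω hω
      rw [hω]
  rw [← h2, h1, h3]
  refine lintegral_congr fun ω => ?_
  rcases Z s ω with q | q
  · rfl
  · rfl

theorem IsMAP.map_eval_eq (h : IsMAP 𝓕 P Z) (p : S × ℝ) (s : ℝ≥0) :
    (P (Sum.inl p)).map (Z s)
      = (P (Sum.inl (p.1, 0))).map fun ω => Sum.map (translate S p.2) id (Z s ω) := by
  have := h.standard.isProbabilityMeasure
  have hm : Measurable fun ω => (Sum.map (translate S p.2) id (Z s ω) : Adj (S × ℝ)) :=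
    (measurable_map_state (translate S p.2).continuous.measurable).comp (h.standard.measurable s)
  have := Measure.isProbabilityMeasure_map (μ := P (Sum.inl p))
    (h.standard.measurable s).aemeasurable
  have := Measure.isProbabilityMeasure_map (μ := P (Sum.inl (p.1, 0))) hm.aemeasurable
  refine ext_of_lintegral_extendZero fun g hg => ?_
  have hg' : Measurable (extendZero g) := measurable_extendZero hg
  rw [lintegral_map hg' (h.standard.measurable s), lintegral_map hg' hm]
  exact h.lintegral_eq p s hg

/-- Translating a Markov additive process amounts to translating its starting point. -/
theorem IsMAP.law_eq_translate (h : IsMAP 𝓕 P Z) (b : ℝ) (x : Adj (S × ℝ)) :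
    (P x).map (fun ω t => Z t ω)
      = (P (Sum.map (translate S b).symm id x)).map
          fun ω t => (Sum.map (translate S b) id (Z t ω) : Adj (S × ℝ)) := by
  -- The translated process is standard too, so comparing the laws at single times is enough.
  refine h.standard.law_eq (h.standard.map (translate S b)) (fun x s => ?_) x
  have hm : ∀ c : ℝ, Measurable (Sum.map (translate S c) id : Adj (S × ℝ) → Adj (S × ℝ)) :=
    fun c => measurable_map_state (translate S c).continuous.measurable
  rcases x with p | ⟨⟩
  · have h1 := congrArg (Measure.map (Sum.map (translate S b) id : Adj (S × ℝ) → Adj (S × ℝ)))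
      (h.map_eval_eq ((translate S b).symm p) s)
    have h2 : Measurable fun ω =>
        (Sum.map (translate S ((translate S b).symm p).2) id (Z s ω) : Adj (S × ℝ)) :=
      (hm _).comp (h.standard.measurable s)
    rw [Measure.map_map (hm _) (h.standard.measurable s), Measure.map_map (hm _) h2] at h1
    refine (h.map_eval_eq p s).trans (Eq.trans ?_ h1.symm)
    rw [translate_symm_apply]
    congr 1
    funext ω
    rw [Function.comp_apply]
    rcases Z s ω with q | q
    · simp only [Sum.map_inl, translate_apply, add_assoc, sub_add_cancel]
    · rfl
  · refine Measure.map_congr ?_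
    filter_upwards [h.standard.ae_cemetery s] with ω hω
    rw [hω]
    rfl

/-- A standard process which is translation invariant in the second coordinate is a Markov additive
process. -/
theorem IsStandardProcess.isMAP (h : IsStandardProcess 𝓕 P Z)
    (hP : ∀ (p : S × ℝ) (s : ℝ≥0), (P (Sum.inl p)).map (Z s)
      = (P (Sum.inl (p.1, 0))).map fun ω => Sum.map (translate S p.2) id (Z s ω)) :
    IsMAP 𝓕 P Z where
  standard := h
  additive x t s f hf A hA := by
    rw [h.markov_lintegral_prod (Sum.inl x) t s hA (measurable_onIncrement hf)]
    refine lintegral_congr fun ω => ?_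
    rcases Z t ω with p | p
    · have hm : Measurable fun ω => (Sum.map (translate S p.2) id (Z s ω) : Adj (S × ℝ)) :=
        (measurable_map_state (translate S p.2).continuous.measurable).comp (h.measurable s)
      have hG : Measurable (onIncrement f (Sum.inl p)) :=
        (measurable_onIncrement hf).comp measurable_prodMk_left
      have h1 := lintegral_map (μ := P (Sum.inl p)) hG (h.measurable s)
      rw [hP p s, lintegral_map hG hm] at h1
      refine h1.symm.trans (lintegral_congr fun ω' => ?_)
      rcases Z s ω' with q | q
      · simp only [onIncrement, Sum.map_inl, translate_apply, add_sub_cancel_right, extendZero,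
          Sum.elim_inl]
      · rfl
    · exact lintegral_zero

end Additive

/-! ### Self-similarity and additivity under the Lamperti transformation -/

section Transform

variable {Ω : Type*} {m : MeasurableSpace Ω} {d : ℕ} {S : Set (UnitSphere d)}
  [LocallyCompactSpace S] {𝓕 : Filtration ℝ≥0 m}

theorem IsMAP.isSsMp (α : ℝ) {P : Adj (S × ℝ) → Measure Ω} {Z : ℝ≥0 → Ω → Adj (S × ℝ)}
    (h : IsMAP 𝓕 P Z) [𝓕.IsRightContinuous] :
    IsSsMp α (timeChangedFiltration h.standard.adapted h.standard.regular
      (isClockWeight_expWeight α)) (ssMpLaw P) (ssMpOfMAP α Z) where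
  standard := (h.standard.timeChange (isClockWeight_expWeight α)).map (polar S)
  scaling a ha x := by
    have hf := isClockWeight_expWeight (S := S) α
    have hr := h.standard.regular
    let b := Real.log a
    let W : ℝ≥0 → Ω → Adj (S × ℝ) := fun t ω => Sum.map (translate S b) id (Z t ω)
    have hW : ∀ t, Measurable (W t) := fun t =>
      (measurable_map_state (translate S b).continuous.measurable).comp (h.standard.measurable t)
    have hrW : ∀ ω, IsRegularPath fun t => W t ω := fun ω => by
      simpa only [one_mul] using (hr ω).map (translate S b).continuous one_pos
    have h1 := law_timeChanged_eq h.standard.measurable hW hr hrW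
      (h.law_eq_translate b (Sum.inl ((polar S).symm x))) hf
    have hΦ : Measurable fun (w : ℝ≥0 → Adj (S × ℝ)) t => (Sum.map (polar S) id (w t) :
        Adj (cone S)) := measurable_pi_lambda _ fun t =>
      (measurable_map_state (polar S).continuous.measurable).comp (measurable_pi_apply t)
    have h2 := congrArg (Measure.map fun (w : ℝ≥0 → Adj (S × ℝ)) t =>
      (Sum.map (polar S) id (w t) : Adj (cone S))) h1
    rw [Measure.map_map hΦ (measurable_path (measurable_timeChanged h.standard.measurable hr hf)),
      Measure.map_map hΦ (measurable_path (measurable_timeChanged hW hrW hf))] at h2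
    refine h2.trans ?_
    have h3 : (Sum.map (polar S).symm id (scale (inv_pos.2 ha) (Sum.inl x)) : Adj (S × ℝ))
        = Sum.map (translate S b).symm id (Sum.inl ((polar S).symm x)) :=
      congrArg Sum.inl (polar_symm_coneSMul_inv ha x)
    rw [ssMpLaw, h3]
    congr 1
    funext ω t
    -- Here `k = 1` and `c = a ^ α`: translation by `log a` speeds up the clock by `a ^ α`, so time
    -- is multiplied by `a ^ (-α)`.
    have h4 := (hr ω).timeChanged_map (W := W) (ω' := ω) hf hf (translate S b).continuous one_pos
      (NNReal.rpow_pos (p := α) ha) (expWeight_translate α ha) (fun t => by rw [one_mul]) t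
    rw [one_div, ← NNReal.rpow_neg] at h4
    refine (congrArg (Sum.map (polar S) id) h4).trans ?_
    rw [ssMpOfMAP, scale_eq]
    rcases timeChanged (expWeight α) Z (a ^ (-α) * t) ω with q | q
    · exact congrArg Sum.inl (polar_translate ha q)
    · rfl

theorem IsSsMp.isMAP (α : ℝ) {P : Adj (cone S) → Measure Ω} {X : ℝ≥0 → Ω → Adj (cone S)}
    (h : IsSsMp α 𝓕 P X) [𝓕.IsRightContinuous] :
    IsMAP (timeChangedFiltration h.standard.adapted h.standard.regular
      (isClockWeight_normWeight α)) (mapLaw P) (mapOfSsMp α X) := by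
  have hf := isClockWeight_normWeight (S := S) α
  have hr := h.standard.regular
  refine ((h.standard.timeChange hf).map (polar S).symm).isMAP fun p s => ?_
  -- The scale is chosen so that dividing `polar S p` by `a` brings the second coordinate to `0`.
  let a : ℝ≥0 := ⟨Real.exp p.2, (Real.exp_pos _).le⟩
  have ha : 0 < a := Real.exp_pos p.2
  have hla : Real.log a = p.2 := Real.log_exp p.2
  have hk : 0 < a ^ (-α) := NNReal.rpow_pos ha
  let W : ℝ≥0 → Ω → Adj (cone S) := fun t ω => scale ha (X (a ^ (-α) * t) ω)
  have hW : ∀ t, Measurable (W t) := fun t =>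
    (measurable_map_state (continuous_coneSMul ha).measurable).comp (h.standard.measurable _)
  have hrW : ∀ ω, IsRegularPath fun t => W t ω := fun ω =>
    (hr ω).map (continuous_coneSMul ha) hk
  have h1 := law_timeChanged_eq h.standard.measurable hW hr hrW (h.scaling a ha (polar S p)) hf
  have hΦ : Measurable fun w : ℝ≥0 → Adj (cone S) => (Sum.map (polar S).symm id (w s) :
      Adj (S × ℝ)) :=
    (measurable_map_state (polar S).symm.continuous.measurable).comp (measurable_pi_apply s)
  have h2 := congrArg (Measure.map fun w : ℝ≥0 → Adj (cone S) =>
    (Sum.map (polar S).symm id (w s) : Adj (S × ℝ))) h1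
  rw [Measure.map_map hΦ (measurable_path (measurable_timeChanged h.standard.measurable hr hf)),
    Measure.map_map hΦ (measurable_path (measurable_timeChanged hW hrW hf))] at h2
  refine h2.trans ?_
  have h3 : scale (inv_pos.2 ha) (Sum.inl (polar S p)) = Sum.inl (polar S (p.1, 0)) := by
    refine congrArg Sum.inl ((polar S).symm.injective ?_)
    have h5 := polar_symm_coneSMul_inv ha (polar S p)
    rw [Homeomorph.symm_apply_apply, translate_symm_apply, hla, sub_self] at h5
    rw [Homeomorph.symm_apply_apply]
    exact h5
  rw [h3]
  refine congrArg (fun g => Measure.map g (P (Sum.inl (polar S (p.1, 0))))) ?_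
  funext ω
  -- The speed factor and the weight factor are both `a ^ (-α)`, so no change of time remains.
  have h4 := (hr ω).timeChanged_map (W := W) (ω' := ω) hf hf (continuous_coneSMul ha) hk hk
    (normWeight_coneSMul α ha) (fun t => rfl) s
  rw [div_self hk.ne', one_mul] at h4
  refine (congrArg (Sum.map (polar S).symm id) h4).trans ?_
  rcases timeChanged (normWeight α) X s ω with q | q
  · refine congrArg Sum.inl ((polar_symm_coneSMul ha q).trans ?_)
    rw [hla]
  · rfl

end Transform

end LampertiMAP

theorem theorem2461 (d : ℕ) (hd : 1 ≤ d) (S : Set (LampertiMAP.UnitSphere d))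
    [LocallyCompactSpace S] (α : ℝ) (hα : 0 ≤ α) {Ω : Type*} [m : MeasurableSpace Ω] :
    -- from Markov additive processes to self-similar Markov processes
    (∀ (𝓕 : Filtration ℝ≥0 m) (P : LampertiMAP.Adj (S × ℝ) → Measure Ω)
      (Z : ℝ≥0 → Ω → LampertiMAP.Adj (S × ℝ)), LampertiMAP.IsMAP 𝓕 P Z →
      -- the process `X` is an ssMp with index `α`, in the time-changed filtration `𝓕_{τ_t}`
      (∃ hτ : ∀ t, IsStoppingTime 𝓕 (LampertiMAP.inverseClock (LampertiMAP.expWeight α) Z t),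
        ∃ 𝓖 : Filtration ℝ≥0 m, (∀ t, 𝓖 t = (hτ t).measurableSpace) ∧
          LampertiMAP.IsSsMp α 𝓖 (LampertiMAP.ssMpLaw P) (LampertiMAP.ssMpOfMAP α Z)) ∧
      -- its lifetime is `∫_0^ζ e^{α ξ_s} ds`
      (∀ ω, LampertiMAP.lifetime (LampertiMAP.ssMpOfMAP α Z) ω
        = LampertiMAP.pathIntegral (LampertiMAP.expWeight α) Z (LampertiMAP.lifetime Z ω) ω) ∧
      -- the converse transformation recovers the Markov additive process
      LampertiMAP.mapOfSsMp α (LampertiMAP.ssMpOfMAP α Z) = Z ∧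
      LampertiMAP.mapLaw (LampertiMAP.ssMpLaw P) = P) ∧
    -- from self-similar Markov processes to Markov additive processes
    (∀ (𝓕 : Filtration ℝ≥0 m) (P : LampertiMAP.Adj (LampertiMAP.cone S) → Measure Ω)
      (X : ℝ≥0 → Ω → LampertiMAP.Adj (LampertiMAP.cone S)), LampertiMAP.IsSsMp α 𝓕 P X →
      -- the process `(θ, ξ)` is a MAP, in the time-changed filtration `𝓕_{A_t}`
      (∃ hA : ∀ t, IsStoppingTime 𝓕 (LampertiMAP.inverseClock (LampertiMAP.normWeight α) X t),
        ∃ 𝓖 : Filtration ℝ≥0 m, (∀ t, 𝓖 t = (hA t).measurableSpace) ∧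
          LampertiMAP.IsMAP 𝓖 (LampertiMAP.mapLaw P) (LampertiMAP.mapOfSsMp α X)) ∧
      -- its lifetime is `∫_0^ζ ‖X_s‖^{-α} ds`
      (∀ ω, LampertiMAP.lifetime (LampertiMAP.mapOfSsMp α X) ω
        = LampertiMAP.pathIntegral (LampertiMAP.normWeight α) X (LampertiMAP.lifetime X ω) ω) ∧
      -- the direct transformation recovers the self-similar Markov process
      LampertiMAP.ssMpOfMAP α (LampertiMAP.mapOfSsMp α X) = X ∧
      LampertiMAP.ssMpLaw (LampertiMAP.mapLaw P) = P) := by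
  refine ⟨fun 𝓕 P Z h => ?_, fun 𝓕 P X h => ?_⟩
  · have := h.standard.rightContinuous_filtration
    exact ⟨⟨LampertiMAP.isStoppingTime_inverseClock h.standard.adapted h.standard.regular
      (LampertiMAP.isClockWeight_expWeight α), _, fun _ => rfl, h.isSsMp α⟩,
      fun ω => LampertiMAP.lifetime_ssMpOfMAP α (h.standard.regular ω),
      LampertiMAP.mapOfSsMp_ssMpOfMAP α h.standard.regular, LampertiMAP.mapLaw_ssMpLaw P⟩
  · have := h.standard.rightContinuous_filtration
    exact ⟨⟨LampertiMAP.isStoppingTime_inverseClock h.standard.adapted h.standard.regular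
      (LampertiMAP.isClockWeight_normWeight α), _, fun _ => rfl, h.isMAP α⟩,
      fun ω => LampertiMAP.lifetime_mapOfSsMp α (h.standard.regular ω),
      LampertiMAP.ssMpOfMAP_mapOfSsMp α h.standard.regular, LampertiMAP.ssMpLaw_mapLaw P⟩
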